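/- Let $d\ge 3$, write $B_r=\{x\in\mathbb R^d:|x|<r\}$. There are constants $C>0$ and $m\in\mathbb N$, depending only on $d$, with the following property. Let $0<\lambda\le\Lambda<\infty$ and let $\mathbf a\colon B_1\to\mathbb R^{d\times d}$ be measurable (not necessarily symmetric) such that, for almost every $x\in B_1$ and every $\xi\in\mathbb R^d$, $$\xi\cdot\mathbf a(x)\xi\ \ge\ \lambda|\xi|^2\qquad\text{and}\qquad \xi\cdot\mathbf a(x)^{-1}\xi\ \ge\ \Lambda^{-1}|\xi|^2 .$$ Let $u$ be a weak subsolution of $-\nabla\cdot(\mathbf a\nabla u)\le 0$ on $B_1$, that is, $u\in W^{1,2}(B_1)$ and $$\int_{B_1}\nabla\varphi\cdot\mathbf a\nabla u\,dx\ \le\ 0\qquad\text{for every nonnegative }\varphi\in W^{1,2}_0(B_1),$$ where $W^{1,2}(B_1)$ is the space of $f\in L^2(B_1)$ all of whose first-order weak partial derivatives exist and lie in $L^2(B_1)$, and $W^{1,2}_0(B_1)$ is the closure of $C_c^\infty(B_1)$ in it. Suppose that $u_+=\max(u,0)\in L^2(B_1)$. Then, for almost every $x\in B_{1/2}$, $$\max(u(x),0)\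 \le\ C_{\mathrm{DG}}\Bigl(\int_{B_1}|u_+|^2\,dx\Bigr)^{1/2},\qquad C_{\mathrm{DG}}=C\,\Bigl(\frac{\Lambda}{\lambda}\Bigr)^{m}.$$ -/

import Mathlib

open MeasureTheory Filter
open scoped ENNReal Topology Distributions

noncomputable section

namespace DeGiorgi

/-- Euclidean space `ℝ^d`, with the Euclidean norm and Lebesgue measure. Functions on an open set
`Ω ⊆ ℝ^d` are represented by functions on `ℝ^d` of which only the values on `Ω` matter. -/
abbrev Space (d : ℕ) : Type := EuclideanSpace ℝ (Fin d)

/-- The open ball `B_r` centred at the origin. -/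
def ballO (d : ℕ) (r : ℝ) : TopologicalSpace.Opens (Space d) :=
  ⟨Metric.ball 0 r, Metric.isOpen_ball⟩

/-- Lebesgue measure on `Ω`. -/
abbrev vol {d : ℕ} (Ω : TopologicalSpace.Opens (Space d)) : Measure (Space d) :=
  (volume : Measure (Space d)).restrict (Ω : Set (Space d))

/-- The classical `i`-th partial derivative. -/
def partialDeriv {d : ℕ} (i : Fin d) (φ : Space d → ℝ) (x : Space d) : ℝ :=
  fderiv ℝ φ x (EuclideanSpace.single i 1)

/-- `g` is a weak `i`-th partial derivative of `f` on `Ω`. -/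
structure IsWeakPartial {d : ℕ} (Ω : TopologicalSpace.Opens (Space d)) (i : Fin d)
    (f g : Space d → ℝ) : Prop where
  locallyIntegrable_left : LocallyIntegrableOn f (Ω : Set (Space d)) volume
  locallyIntegrable_right : LocallyIntegrableOn g (Ω : Set (Space d)) volume
  integral_eq : ∀ φ : 𝓓(Ω, ℝ),
    ∫ x, f x * partialDeriv i φ x ∂(vol Ω) = -∫ x, g x * φ x ∂(vol Ω)

/-- `f ∈ W^{1,p}(Ω)`. -/
def MemW1 {d : ℕ} (Ω : TopologicalSpace.Opens (Space d)) (p : ℝ≥0∞) (f : Space d → ℝ) : Prop :=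
  MemLp f p (vol Ω) ∧ ∀ i : Fin d, ∃ g, IsWeakPartial Ω i f g ∧ MemLp g p (vol Ω)

open Classical in
/-- The weak `i`-th partial derivative of `f` on `Ω` (a choice of representative; `0` if there is
no weak partial derivative). -/
def weakPartial {d : ℕ} (Ω : TopologicalSpace.Opens (Space d)) (i : Fin d)
    (f : Space d → ℝ) : Space d → ℝ :=
  if h : ∃ g, IsWeakPartial Ω i f g then h.choose else 0

/-- The weak gradient of `f` on `Ω`. -/
def weakGrad {d : ℕ} (Ω : TopologicalSpace.Opens (Space d)) (f : Space d → ℝ)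
    (x : Space d) : Space d :=
  WithLp.toLp 2 fun i => weakPartial Ω i f x

/-- `f ∈ W^{1,2}_0(Ω)`: `f` is in the closure of `C_c^∞(Ω)` in `W^{1,2}(Ω)`, that is, it is the
limit, in `L²` together with all first partial derivatives, of a sequence of test functions. -/
def MemW120 {d : ℕ} (Ω : TopologicalSpace.Opens (Space d)) (f : Space d → ℝ) : Prop :=
  MemW1 Ω 2 f ∧ ∃ φ : ℕ → 𝓓(Ω, ℝ),
    Tendsto (fun n => eLpNorm (fun x => φ n x - f x) 2 (vol Ω)) atTop (𝓝 0) ∧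
    ∀ i : Fin d, Tendsto
      (fun n => eLpNorm (fun x => partialDeriv i (φ n) x - weakPartial Ω i f x) 2 (vol Ω))
      atTop (𝓝 0)

/-- `a` is an elliptic coefficient field on `Ω` with ellipticity constants `lam ≤ Lam`. -/
structure IsElliptic {d : ℕ} (Ω : TopologicalSpace.Opens (Space d))
    (a : Space d → Matrix (Fin d) (Fin d) ℝ) (lam Lam : ℝ) : Prop where
  lam_pos : 0 < lam
  lam_le : lam ≤ Lam
  measurable : ∀ i j, AEMeasurable (fun x => a x i j) (vol Ω)
  coercive : ∀ᵐ x ∂(vol Ω), ∀ ξ : Space d,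
    lam * ‖ξ‖ ^ 2 ≤ inner ℝ ξ (Matrix.toEuclideanLin (a x) ξ) ∧
    Lam⁻¹ * ‖ξ‖ ^ 2 ≤ inner ℝ ξ (Matrix.toEuclideanLin (a x)⁻¹ ξ)

/-- `B_a(u, φ) = ∫_Ω ∇φ · a ∇u`. -/
def bilin {d : ℕ} (Ω : TopologicalSpace.Opens (Space d))
    (a : Space d → Matrix (Fin d) (Fin d) ℝ) (u φ : Space d → ℝ) : ℝ :=
  ∫ x, inner ℝ (weakGrad Ω φ x) (Matrix.toEuclideanLin (a x) (weakGrad Ω u x)) ∂(vol Ω)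

/-- `u` is a weak subsolution of `-∇ · (a ∇u) ≤ 0` on `Ω`. -/
def IsWeakSubsolution {d : ℕ} (Ω : TopologicalSpace.Opens (Space d))
    (a : Space d → Matrix (Fin d) (Fin d) ℝ) (u : Space d → ℝ) : Prop :=
  MemW1 Ω 2 u ∧
    ∀ φ : Space d → ℝ, MemW120 Ω φ → (∀ᵐ x ∂(vol Ω), 0 ≤ φ x) → bilin Ω a u φ ≤ 0

/-- Weak partial derivatives are unique up to null sets, so that `weakPartial` is well defined. -/
theorem IsWeakPartial.ae_eq_weakPartial {d : ℕ} {Ω : TopologicalSpace.Opens (Space d)} {i : Fin d}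
    {f g : Space d → ℝ} (h : IsWeakPartial Ω i f g) : weakPartial Ω i f =ᵐ[vol Ω] g := by
  have hex : ∃ g, IsWeakPartial Ω i f g := ⟨g, h⟩
  have h' : IsWeakPartial Ω i f (weakPartial Ω i f) := by
    rw [weakPartial, dif_pos hex]
    exact hex.choose_spec
  have hint : ∀ {k : Space d → ℝ}, LocallyIntegrableOn k (Ω : Set (Space d)) volume →
      ∀ φ : 𝓓(Ω, ℝ), Integrable (fun x => φ x * k x) := by
    intro k hk φ
    have := (hk.integrableOn_compact_subset φ.tsupport_subset
      φ.hasCompactSupport).continuousOn_mul φ.continuous.continuousOn φ.hasCompactSupport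
    refine (integrableOn_iff_integrable_of_support_subset ?_).1 this
    intro x hx
    exact subset_tsupport _ (fun h0 => hx (by simp [h0]))
  have key := Ω.isOpen.ae_eq_zero_of_integral_contDiff_smul_eq_zero (μ := volume)
    (f := fun x => weakPartial Ω i f x - g x)
    (h'.locallyIntegrable_right.sub h.locallyIntegrable_right) (by
      intro φ h1 h2 h3
      let ψ : 𝓓(Ω, ℝ) := ⟨φ, h1, h2, h3⟩
      have e := (h'.integral_eq ψ).symm.trans (h.integral_eq ψ)
      have hrestr : ∀ k : Space d → ℝ,
          ∫ x, k x * ψ x ∂(vol Ω) = ∫ x, ψ x * k x := by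
        intro k
        rw [setIntegral_eq_integral_of_forall_compl_eq_zero]
        · simp only [mul_comm]
        · intro x hx
          have : ψ x = 0 := by
            by_contra h0
            exact hx (h3 (subset_tsupport _ h0))
          simp [this]
      rw [hrestr, hrestr, neg_inj] at e
      change ∫ x, ψ x * (weakPartial Ω i f x - g x) = 0
      simp only [mul_sub]
      rw [integral_sub (hint h'.locallyIntegrable_right ψ) (hint h.locallyIntegrable_right ψ), e,
        sub_self])
  refine (ae_restrict_iff' Ω.isOpen.measurableSet).2 ?_
  filter_upwards [key] with x hx hxΩ
  exact sub_eq_zero.1 (hx hxΩ)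

end DeGiorgi

end

/-! The proof is De Giorgi's iteration.

A subsolution `u` is tested with `η² β(u - k)`, where `η` is a cutoff function, `k ≥ 0` is a level
and `β` is a smooth approximation of the positive part. The two ellipticity conditions give
`|a ∇u|² ≤ Λ ∇u · a ∇u`, so that Young's inequality absorbs the mixed term of
`∇(η² β(u - k)) · a ∇u`; the result is the Caccioppoli inequality `DeGiorgi.caccioppoli`, a bound
of `∇(η β(u - k))` in `L²` by `∇η (u - k)₊`, with a constant linear in `Λ / λ`. Because the test
function is linear in `u` at infinity, no truncation from above is needed, and because `β` is
smooth, neither is the chain rule for the positive part of a Sobolev function.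

All facts about Sobolev functions come from one approximation result,
`DeGiorgi.exists_testFunction_tendsto`: for a test function `ζ` the product `ζ β(u)` is an `L²`
limit of test functions whose partial derivatives converge to the expected expressions. It gives
the admissibility of the test function in the definition of a subsolution
(`DeGiorgi.memW120_of_tendsto`), and it carries the Gagliardo-Nirenberg-Sobolev inequality from
test functions to `η β(u - k)` (`DeGiorgi.exists_sobolev_const`). The approximating sequence is
obtained by mollification.

Combining the Caccioppoli and Sobolev inequalities with Hölder's inequality and the Chebyshev bound
for the measure of `{u > h}`, for levels `k < h` and radii `r < R`, gives
`‖(u - h)₊‖²_{B_r} ≤ C (Λ / λ) (R - r)⁻² (h - k)^(-4/d) ‖(u - k)₊‖_{B_R}^(2 + 4/d)`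
(`DeGiorgi.exists_deGiorgi_step`). For radii decreasing to `1 / 2` and levels increasing to `K`,
the superlinear power makes the energies decay geometrically as soon as `K` is a large enough
multiple of the `L²` norm of `u₊` (`DeGiorgi.le_geometric_of_deGiorgi_recursion`); the energy above
the level `K` on `B_{1/2}` then vanishes. The level has to satisfy `K² ≥ C (Λ / λ)^(d/2) ‖u₊‖²`; the
larger power `(Λ / λ)^d` in `K` avoids fractional exponents. -/

namespace DeGiorgi

open scoped Convolution
open ContinuousLinearMap (lsmul)

variable {d : ℕ}

/-! ### Mollification in `L²` -/

/-- Young's inequality for the convolution of an `L²` function with a probability density. -/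
theorem eLpNorm_convolution_le {ψ f : Space d → ℝ} (hψ : Continuous ψ) (hψ0 : ∀ x, 0 ≤ ψ x)
    (hψi : Integrable ψ) (hψ1 : ∫ x, ψ x = 1) (hf : AEStronglyMeasurable f volume) :
    eLpNorm (ψ ⋆[lsmul ℝ ℝ, volume] f) 2 volume ≤ eLpNorm f 2 volume := by
  have hψ1' : ∫⁻ t, ‖ψ t‖ₑ = 1 := by
    rw [← ofReal_integral_norm_eq_lintegral_enorm hψi]
    simp [abs_of_nonneg (hψ0 _), hψ1]
  have hpt : ∀ x, ‖(ψ ⋆[lsmul ℝ ℝ, volume] f) x‖ₑ ^ (2 : ℝ)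
      ≤ ∫⁻ t, ‖ψ t‖ₑ * ‖f (x - t)‖ₑ ^ (2 : ℝ) := by
    intro x
    have hfx : AEMeasurable (fun t => ‖f (x - t)‖ₑ) volume :=
      (hf.comp_quasiMeasurePreserving
        (quasiMeasurePreserving_sub_left_of_right_invariant volume x)).enorm
    have hψm : AEMeasurable (fun t => ‖ψ t‖ₑ) volume := hψ.aestronglyMeasurable.enorm
    have h1 : ‖(ψ ⋆[lsmul ℝ ℝ, volume] f) x‖ₑ ≤ ∫⁻ t, ‖ψ t‖ₑ * ‖f (x - t)‖ₑ := by
      rw [convolution_lsmul]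
      refine (enorm_integral_le_lintegral_enorm _).trans (le_of_eq ?_)
      simp [enorm_mul]
    -- Hölder's inequality for the splitting `ψ |f| = ψ^(1/2) * (ψ^(1/2) |f|)`
    have h2 := ENNReal.lintegral_mul_le_Lp_mul_Lq volume Real.HolderConjugate.two_two
      (f := fun t => ‖ψ t‖ₑ ^ (1 / 2 : ℝ)) (g := fun t => ‖ψ t‖ₑ ^ (1 / 2 : ℝ) * ‖f (x - t)‖ₑ)
      (hψm.pow_const _) ((hψm.pow_const _).mul hfx)
    have e1 : ∀ t, ((fun t => ‖ψ t‖ₑ ^ (1 / 2 : ℝ)) *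
        (fun t => ‖ψ t‖ₑ ^ (1 / 2 : ℝ) * ‖f (x - t)‖ₑ)) t = ‖ψ t‖ₑ * ‖f (x - t)‖ₑ := by
      intro t
      simp only [Pi.mul_apply]
      rw [← mul_assoc, ← ENNReal.rpow_add_of_nonneg _ _ (by norm_num) (by norm_num)]
      norm_num
    have e2 : ∀ t, (‖ψ t‖ₑ ^ (1 / 2 : ℝ)) ^ (2 : ℝ) = ‖ψ t‖ₑ := by
      intro t
      rw [← ENNReal.rpow_mul]; norm_num
    have e3 : ∀ t, (‖ψ t‖ₑ ^ (1 / 2 : ℝ) * ‖f (x - t)‖ₑ) ^ (2 : ℝ)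
        = ‖ψ t‖ₑ * ‖f (x - t)‖ₑ ^ (2 : ℝ) := by
      intro t
      rw [ENNReal.mul_rpow_of_nonneg _ _ (by norm_num), e2]
    simp only [e1, e2, e3, hψ1', ENNReal.one_rpow, one_mul] at h2
    calc _ ≤ ((∫⁻ t, ‖ψ t‖ₑ * ‖f (x - t)‖ₑ ^ (2 : ℝ)) ^ (1 / 2 : ℝ)) ^ (2 : ℝ) := by
          gcongr
          exact h1.trans h2
      _ = _ := by rw [← ENNReal.rpow_mul]; norm_num
  rw [eLpNorm_eq_lintegral_rpow_enorm_toReal (by norm_num) (by norm_num),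
    eLpNorm_eq_lintegral_rpow_enorm_toReal (by norm_num) (by norm_num)]
  simp only [ENNReal.toReal_ofNat]
  refine ENNReal.rpow_le_rpow ?_ (by norm_num)
  calc _ ≤ ∫⁻ x, ∫⁻ t, ‖ψ t‖ₑ * ‖f (x - t)‖ₑ ^ (2 : ℝ) := lintegral_mono hpt
    _ = ∫⁻ t, ∫⁻ x, ‖ψ t‖ₑ * ‖f (x - t)‖ₑ ^ (2 : ℝ) := by
        refine lintegral_lintegral_swap ?_
        have h1 : AEMeasurable (fun p : Space d × Space d => ‖ψ p.2‖ₑ) (volume.prod volume) :=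
          (hψ.comp continuous_snd).aestronglyMeasurable.enorm
        have h2 : AEMeasurable (fun p : Space d × Space d => ‖f (p.1 - p.2)‖ₑ)
            (volume.prod volume) :=
          (hf.comp_quasiMeasurePreserving
            (quasiMeasurePreserving_sub_of_right_invariant volume volume)).enorm
        exact h1.mul (h2.pow_const _)
    _ = ∫⁻ t, ‖ψ t‖ₑ * ∫⁻ x, ‖f x‖ₑ ^ (2 : ℝ) := by
        refine lintegral_congr fun t => ?_
        rw [lintegral_const_mul' _ _ (by simp),
          lintegral_sub_right_eq_self (fun x => ‖f x‖ₑ ^ (2 : ℝ)) t]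
    _ = _ := by
        rw [lintegral_mul_const'' _ hψ.aestronglyMeasurable.enorm, hψ1', one_mul]

/-- Mollifications of a continuous function of compact support converge in `L²`: they converge
uniformly, and their supports stay in a fixed bounded set. -/
theorem tendsto_eLpNorm_mollify_sub_of_continuous {φ : ℕ → ContDiffBump (0 : Space d)}
    (hφ : Tendsto (fun n => (φ n).rOut) atTop (𝓝 0)) {g : Space d → ℝ}
    (hg : Continuous g) (hgs : HasCompactSupport g) :
    Tendsto (fun n => eLpNorm (fun x => ((φ n).normed volume ⋆[lsmul ℝ ℝ, volume] g) x - g x) 2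
      volume) atTop (𝓝 0) := by
  obtain ⟨K, hK⟩ : ∃ K : Set (Space d), K = Metric.cthickening 1 (tsupport g) := ⟨_, rfl⟩
  have hKc : IsCompact K := hK ▸ hgs.isCompact.cthickening
  have huc := hgs.uniformContinuous_of_continuous hg
  have hmeas : Tendsto (fun ε : ℝ≥0∞ => ε * volume K ^ (1 / 2 : ℝ)) (𝓝 0) (𝓝 0) := by
    have h := ENNReal.Tendsto.mul_const (b := volume K ^ (1 / 2 : ℝ)) (m := id) (f := 𝓝 (0 : ℝ≥0∞))
      tendsto_id (Or.inr (ENNReal.rpow_ne_top_of_nonneg (by norm_num) hKc.measure_lt_top.ne))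
    simpa using h
  rw [ENNReal.tendsto_nhds_zero]
  intro ε hε
  obtain ⟨δ, hδ0, hδ⟩ : ∃ δ : ℝ, 0 < δ ∧ ENNReal.ofReal δ * volume K ^ (1 / 2 : ℝ) ≤ ε := by
    have h1 : Tendsto (fun δ : ℝ => ENNReal.ofReal δ * volume K ^ (1 / 2 : ℝ)) (𝓝[>] 0) (𝓝 0) := by
      refine hmeas.comp ?_
      have := (ENNReal.continuous_ofReal.tendsto 0)
      rw [ENNReal.ofReal_zero] at this
      exact this.mono_left nhdsWithin_le_nhds
    have h2 := (ENNReal.tendsto_nhds_zero.1 h1 ε hε).and self_mem_nhdsWithin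
    obtain ⟨δ, h3, h4⟩ := h2.exists
    exact ⟨δ, h4, h3⟩
  obtain ⟨η, hη0, hη⟩ := Metric.uniformContinuous_iff.1 huc δ hδ0
  have hsmall : ∀ᶠ n in atTop, (φ n).rOut < min η 1 :=
    hφ.eventually_lt_const (by positivity)
  filter_upwards [hsmall] with n hn
  have hsupp : ∀ x, x ∉ K → ((φ n).normed volume ⋆[lsmul ℝ ℝ, volume] g) x - g x = 0 := by
    intro x hx
    have hball : ∀ y ∈ Metric.ball x (φ n).rOut, g y = 0 := by
      intro y hy
      by_contra h0
      refine hx (hK ▸ Metric.mem_cthickening_of_dist_le x y 1 _ (subset_tsupport _ h0) ?_)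
      rw [dist_comm]
      exact (Metric.mem_ball.1 hy).le.trans (hn.le.trans (min_le_right _ _))
    have hx0 : g x = 0 := hball x (Metric.mem_ball_self (φ n).rOut_pos)
    rw [(φ n).normed_convolution_eq_right (fun y hy => by rw [hball y hy, hx0]), sub_self]
  have hbd : ∀ x, ‖((φ n).normed volume ⋆[lsmul ℝ ℝ, volume] g) x - g x‖ ≤ δ := by
    intro x
    rw [← dist_eq_norm]
    refine (φ n).dist_normed_convolution_le hg.aestronglyMeasurable fun y hy => (hη ?_).le
    exact (Metric.mem_ball.1 hy).trans (hn.trans_le (min_le_left _ _))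
  have hs : Function.support (fun x => ((φ n).normed volume ⋆[lsmul ℝ ℝ, volume] g) x - g x) ⊆ K :=
    fun x hx => by_contra fun h => hx (hsupp x h)
  rw [← eLpNorm_restrict_eq_of_support_subset hs]
  refine (eLpNorm_le_of_ae_bound (Eventually.of_forall hbd)).trans ?_
  rw [mul_comm]
  simpa using hδ

/-- Mollifications of an `L²` function converge to it in `L²`: mollification is a contraction of
`L²`, so that it is enough to treat the dense subspace of continuous functions of compact
support. -/
theorem tendsto_eLpNorm_mollify_sub {φ : ℕ → ContDiffBump (0 : Space d)}
    (hφ : Tendsto (fun n => (φ n).rOut) atTop (𝓝 0)) {f : Space d → ℝ} (hf : MemLp f 2 volume) :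
    Tendsto (fun n => eLpNorm (fun x => ((φ n).normed volume ⋆[lsmul ℝ ℝ, volume] f) x - f x) 2
      volume) atTop (𝓝 0) := by
  rw [ENNReal.tendsto_nhds_zero]
  intro ε hε
  have hε3 : ε / 3 ≠ 0 := by simp [hε.ne']
  obtain ⟨g, hgs, hgε, hgc, hgm⟩ := hf.exists_hasCompactSupport_eLpNorm_sub_le (by simp) hε3
  filter_upwards [ENNReal.tendsto_nhds_zero.1
    (tendsto_eLpNorm_mollify_sub_of_continuous hφ hgc hgs) (ε / 3) (by positivity)] with n hn
  set ψ := (φ n).normed volume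
  have hψc : Continuous ψ := (φ n).continuous_normed
  have hψs : HasCompactSupport ψ := (φ n).hasCompactSupport_normed
  have hfl : LocallyIntegrable f volume := hf.locallyIntegrable (by norm_num)
  have hgl : LocallyIntegrable g volume := hgm.locallyIntegrable (by norm_num)
  have hcg : ConvolutionExists ψ g (lsmul ℝ ℝ) volume :=
    hψs.convolutionExists_left _ hψc hgl
  have hcgc : Continuous (ψ ⋆[lsmul ℝ ℝ, volume] g) := hψs.continuous_convolution_left _ hψc hgl
  have hdec : (fun x => (ψ ⋆[lsmul ℝ ℝ, volume] f) x - f x) =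
      ((ψ ⋆[lsmul ℝ ℝ, volume] (f - g)) + fun x => (ψ ⋆[lsmul ℝ ℝ, volume] g) x - g x)
        + (g - f) := by
    have hfg : f = (f - g) + g := by simp
    have hcfg : ConvolutionExists ψ (f - g) (lsmul ℝ ℝ) volume :=
      hψs.convolutionExists_left _ hψc (hfl.sub hgl)
    have h := hcfg.distrib_add hcg
    rw [← hfg] at h
    ext x
    simp [h]
    ring
  rw [hdec]
  have h1 : eLpNorm (ψ ⋆[lsmul ℝ ℝ, volume] (f - g)) 2 volume ≤ ε / 3 :=
    (eLpNorm_convolution_le hψc (φ n).nonneg_normed (φ n).integrable_normed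
      (φ n).integral_normed (hf.sub hgm).1).trans hgε
  have h3 : eLpNorm (g - f) 2 volume ≤ ε / 3 := by rwa [eLpNorm_sub_comm]
  have hm1 : AEStronglyMeasurable (ψ ⋆[lsmul ℝ ℝ, volume] (f - g)) volume :=
    (hψs.continuous_convolution_left _ hψc (hfl.sub hgl)).aestronglyMeasurable
  have hm2 : AEStronglyMeasurable (fun x => (ψ ⋆[lsmul ℝ ℝ, volume] g) x - g x) volume :=
    (hcgc.sub hgc).aestronglyMeasurable
  calc _ ≤ (ε / 3 + ε / 3) + ε / 3 :=
        (eLpNorm_add_le (hm1.add hm2) (hgm.1.sub hf.1) (by norm_num)).trans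
          (add_le_add ((eLpNorm_add_le hm1 hm2 (by norm_num)).trans (add_le_add h1 hn)) h3)
    _ = ε := ENNReal.add_thirds ε

/-! ### Smooth approximation of Sobolev functions -/

theorem fderiv_convolution {ψ U : Space d → ℝ} (hψs : HasCompactSupport ψ)
    (hψ1 : ContDiff ℝ 1 ψ) (hU : LocallyIntegrable U volume) (x : Space d) :
    fderiv ℝ (ψ ⋆[lsmul ℝ ℝ, volume] U) x =
      (fderiv ℝ ψ ⋆[(lsmul ℝ ℝ).precompL (Space d), volume] U) x :=
  (hψs.hasFDerivAt_convolution_left (lsmul ℝ ℝ) hψ1 hU x).fderiv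

theorem convolutionExistsAt_fderiv {ψ U : Space d → ℝ} (hψs : HasCompactSupport ψ)
    (hψ1 : ContDiff ℝ 1 ψ) (hU : LocallyIntegrable U volume) (x : Space d) :
    ConvolutionExistsAt (fderiv ℝ ψ) U x
      ((lsmul ℝ ℝ : ℝ →L[ℝ] ℝ →L[ℝ] ℝ).precompL (Space d)) volume :=
  (hψs.fderiv (𝕜 := ℝ)).convolutionExists_left _ (hψ1.continuous_fderiv one_ne_zero) hU x

theorem partialDeriv_convolution {ψ U : Space d → ℝ} (hψs : HasCompactSupport ψ)
    (hψ1 : ContDiff ℝ 1 ψ) (hU : LocallyIntegrable U volume) (i : Fin d) (x : Space d) :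
    partialDeriv i (ψ ⋆[lsmul ℝ ℝ, volume] U) x =
      ∫ y, fderiv ℝ ψ (x - y) (EuclideanSpace.single i 1) * U y := by
  have hint := convolutionExistsAt_fderiv hψs hψ1 hU x
  unfold ConvolutionExistsAt at hint
  have e1 : partialDeriv i (ψ ⋆[lsmul ℝ ℝ, volume] U) x =
      ∫ t, fderiv ℝ ψ t (EuclideanSpace.single i 1) * U (x - t) := by
    rw [partialDeriv, fderiv_convolution hψs hψ1 hU, convolution_def,
      ContinuousLinearMap.integral_apply hint]
    rfl
  rw [e1, ← integral_sub_left_eq_self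
    (fun t => fderiv ℝ ψ t (EuclideanSpace.single i 1) * U (x - t)) volume x]
  simp

/-- If the reflected translate `y ↦ ψ (x - y)` of a mollifier `ψ` is a test function on `Ω`, then
at `x` a partial derivative of the mollification of `u` (extended by zero) is the mollification of
the weak partial derivative of `u`. -/
theorem partialDeriv_mollify {Ω : TopologicalSpace.Opens (Space d)} {i : Fin d}
    {u g : Space d → ℝ} (h : IsWeakPartial Ω i u g) (hu : MemLp u 2 (vol Ω))
    {ψ : Space d → ℝ} (hψs : HasCompactSupport ψ) (hψd : ContDiff ℝ (⊤ : ℕ∞) ψ) {x : Space d}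
    {r : ℝ} (hψr : Function.support ψ ⊆ Metric.ball 0 r)
    (hx : Metric.closedBall x r ⊆ (Ω : Set (Space d))) :
    partialDeriv i (ψ ⋆[lsmul ℝ ℝ, volume] (Ω : Set (Space d)).indicator u) x =
      (ψ ⋆[lsmul ℝ ℝ, volume] (Ω : Set (Space d)).indicator g) x := by
  have hΩm : MeasurableSet (Ω : Set (Space d)) := Ω.isOpen.measurableSet
  have hψ1 : ContDiff ℝ 1 ψ := hψd.of_le (by simp)
  have hUl : LocallyIntegrable ((Ω : Set (Space d)).indicator u) volume :=
    ((memLp_indicator_iff_restrict hΩm).2 hu).locallyIntegrable (by norm_num)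
  have hts : tsupport (fun y => ψ (x - y)) ⊆ Metric.closedBall x r := by
    refine closure_minimal (fun y hy => ?_) Metric.isClosed_closedBall
    have h1 := hψr (show x - y ∈ Function.support ψ from hy)
    rw [Metric.mem_closedBall, dist_comm, dist_eq_norm]
    exact (mem_ball_zero_iff.1 h1).le
  obtain ⟨T, hT⟩ : ∃ T : 𝓓(Ω, ℝ), ⇑T = fun y => ψ (x - y) :=
    ⟨⟨fun y => ψ (x - y), hψd.comp (contDiff_const.sub contDiff_id),
      (isCompact_closedBall x r).of_isClosed_subset (isClosed_tsupport _) hts, hts.trans hx⟩, rfl⟩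
  have hTd : ∀ y, partialDeriv i T y = - fderiv ℝ ψ (x - y) (EuclideanSpace.single i 1) := by
    intro y
    have h1 : HasFDerivAt (fun y : Space d => x - y) (-ContinuousLinearMap.id ℝ (Space d)) y := by
      simpa using (hasFDerivAt_id y).const_sub x
    have h2 := ((hψ1.differentiable one_ne_zero (x - y)).hasFDerivAt).comp y h1
    rw [partialDeriv, hT, show (fun y => ψ (x - y)) = ψ ∘ fun y => x - y from rfl, h2.fderiv]
    simp
  have e3 : ∫ y, fderiv ℝ ψ (x - y) (EuclideanSpace.single i 1) *
      (Ω : Set (Space d)).indicator u y = - ∫ y, u y * partialDeriv i T y ∂(vol Ω) := by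
    rw [← integral_indicator hΩm, ← integral_neg]
    refine integral_congr_ae (Eventually.of_forall fun y => ?_)
    by_cases hy : y ∈ (Ω : Set (Space d))
    · simp only [Set.indicator_of_mem hy, hTd]; ring
    · simp [Set.indicator_of_notMem hy]
  have e4 : ∫ y, g y * T y ∂(vol Ω) =
      (ψ ⋆[lsmul ℝ ℝ, volume] (Ω : Set (Space d)).indicator g) x := by
    rw [convolution_lsmul_swap, ← integral_indicator hΩm]
    refine integral_congr_ae (Eventually.of_forall fun y => ?_)
    by_cases hy : y ∈ (Ω : Set (Space d))
    · simp only [Set.indicator_of_mem hy, smul_eq_mul, hT]; exact mul_comm _ _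
    · simp [Set.indicator_of_notMem hy]
  rw [partialDeriv_convolution hψs hψ1 hUl, e3, h.integral_eq T, neg_neg, e4]

theorem vol_restrict_of_subset {Ω : TopologicalSpace.Opens (Space d)} {K : Set (Space d)}
    (hK : MeasurableSet K) (hKΩ : K ⊆ Ω) : (vol Ω).restrict K = volume.restrict K := by
  rw [Measure.restrict_restrict hK, Set.inter_eq_left.2 hKΩ]

/-- On a compact subset of `Ω`, a function of `W^{1,2}(Ω)` is a limit of smooth functions, in `L²`
together with all first partial derivatives, and almost everywhere. -/
theorem exists_contDiff_tendsto {Ω : TopologicalSpace.Opens (Space d)} {u : Space d → ℝ}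
    {g : Fin d → Space d → ℝ} (hu : MemLp u 2 (vol Ω)) (hg : ∀ i, MemLp (g i) 2 (vol Ω))
    (h : ∀ i, IsWeakPartial Ω i u (g i)) {K : Set (Space d)} (hK : IsCompact K)
    (hKΩ : K ⊆ Ω) :
    ∃ w : ℕ → Space d → ℝ, (∀ n, ContDiff ℝ (⊤ : ℕ∞) (w n)) ∧
      Tendsto (fun n => eLpNorm (fun x => w n x - u x) 2 (volume.restrict K)) atTop (𝓝 0) ∧
      (∀ i, Tendsto (fun n => eLpNorm (fun x => partialDeriv i (w n) x - g i x) 2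
        (volume.restrict K)) atTop (𝓝 0)) ∧
      ∀ᵐ x ∂(volume.restrict K), Tendsto (fun n => w n x) atTop (𝓝 (u x)) := by
  have hΩm : MeasurableSet (Ω : Set (Space d)) := Ω.isOpen.measurableSet
  obtain ⟨δ, hδ0, hδ⟩ := hK.exists_cthickening_subset_open Ω.isOpen hKΩ
  let φ : ℕ → ContDiffBump (0 : Space d) := fun n =>
    ⟨δ / 2 * (1 / ((n : ℝ) + 1)), δ * (1 / ((n : ℝ) + 1)), by positivity, by
      have : 0 < 1 / ((n : ℝ) + 1) := by positivity
      nlinarith⟩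
  have hφ : Tendsto (fun n => (φ n).rOut) atTop (𝓝 0) := by
    have h1 := (tendsto_one_div_add_atTop_nhds_zero_nat (𝕜 := ℝ)).const_mul δ
    rwa [mul_zero] at h1
  have hφδ : ∀ n, (φ n).rOut ≤ δ := by
    intro n
    change δ * (1 / ((n : ℝ) + 1)) ≤ δ
    refine mul_le_of_le_one_right hδ0.le ?_
    rw [div_le_one (by positivity)]
    linarith [(Nat.cast_nonneg n : (0 : ℝ) ≤ n)]
  have hext : ∀ {f : Space d → ℝ}, MemLp f 2 (vol Ω) →
      MemLp ((Ω : Set (Space d)).indicator f) 2 volume := fun hf =>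
    (memLp_indicator_iff_restrict hΩm).2 hf
  have hlim : ∀ {f : Space d → ℝ}, MemLp f 2 (vol Ω) → Tendsto (fun n => eLpNorm (fun x =>
      ((φ n).normed volume ⋆[lsmul ℝ ℝ, volume] (Ω : Set (Space d)).indicator f) x - f x) 2
      (volume.restrict K)) atTop (𝓝 0) := by
    intro f hf
    refine tendsto_of_tendsto_of_tendsto_of_le_of_le tendsto_const_nhds
      (tendsto_eLpNorm_mollify_sub hφ (hext hf)) (fun _ => zero_le) fun n => ?_
    refine le_trans (le_of_eq (eLpNorm_congr_ae ?_))
      (eLpNorm_mono_measure _ (Measure.restrict_le_self (s := K)))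
    filter_upwards [ae_restrict_mem hK.measurableSet] with x hx
    rw [Set.indicator_of_mem (hKΩ hx)]
  have hl := (hext hu).locallyIntegrable (by norm_num)
  set w : ℕ → Space d → ℝ := fun n =>
    (φ n).normed volume ⋆[lsmul ℝ ℝ, volume] (Ω : Set (Space d)).indicator u with hw
  have hwd : ∀ n, ContDiff ℝ (⊤ : ℕ∞) (w n) := fun n =>
    (φ n).hasCompactSupport_normed.contDiff_convolution_left _ (φ n).contDiff_normed hl
  have hgrad : ∀ i, Tendsto (fun n => eLpNorm (fun x => partialDeriv i (w n) x - g i x) 2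
      (volume.restrict K)) atTop (𝓝 0) := by
    intro i
    refine (hlim (hg i)).congr fun n => eLpNorm_congr_ae ?_
    filter_upwards [ae_restrict_mem hK.measurableSet] with x hx
    rw [hw, partialDeriv_mollify (h i) hu (φ n).hasCompactSupport_normed (φ n).contDiff_normed
      (φ n).support_normed_eq.le]
    exact (Metric.closedBall_subset_closedBall (hφδ n)).trans
      ((Metric.closedBall_subset_cthickening hx δ).trans hδ)
  have hum : AEStronglyMeasurable u (volume.restrict K) :=
    hu.1.mono_measure (Measure.restrict_mono hKΩ le_rfl)
  obtain ⟨ns, hns, hae⟩ := (tendstoInMeasure_of_tendsto_eLpNorm (by norm_num)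
    (fun n => (hwd n).continuous.aestronglyMeasurable) hum (hlim hu)).exists_seq_tendsto_ae
  exact ⟨fun n => w (ns n), fun n => hwd _, (hlim hu).comp hns.tendsto_atTop,
    fun i => (hgrad i).comp hns.tendsto_atTop, hae⟩

/-- Dominated convergence in `L²`. -/
theorem tendsto_eLpNorm_zero_of_dominated {μ : Measure (Space d)} {h : ℕ → Space d → ℝ}
    {G : Space d → ℝ} (hm : ∀ n, AEStronglyMeasurable (h n) μ) (hG : MemLp G 2 μ)
    (hle : ∀ n, ∀ᵐ x ∂μ, ‖h n x‖ ≤ ‖G x‖)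
    (hlim : ∀ᵐ x ∂μ, Tendsto (fun n => h n x) atTop (𝓝 0)) :
    Tendsto (fun n => eLpNorm (h n) 2 μ) atTop (𝓝 0) := by
  have hfin : ∫⁻ x, ‖G x‖ₑ ^ (2 : ℝ) ∂μ ≠ ∞ := by
    have := lintegral_rpow_enorm_lt_top_of_eLpNorm_lt_top (by norm_num) (by norm_num) hG.2
    simpa using this.ne
  have key : Tendsto (fun n => ∫⁻ x, ‖h n x‖ₑ ^ (2 : ℝ) ∂μ) atTop (𝓝 (∫⁻ _, 0 ∂μ)) := by
    refine tendsto_lintegral_of_dominated_convergence' (fun x => ‖G x‖ₑ ^ (2 : ℝ))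
      (fun n => (hm n).enorm.pow_const _) (fun n => ?_) hfin ?_
    · filter_upwards [hle n] with x hx
      exact ENNReal.rpow_le_rpow (enorm_le_iff_norm_le.2 hx) (by norm_num)
    · filter_upwards [hlim] with x hx
      have h1 := (ENNReal.continuous_rpow_const (y := (2 : ℝ))).tendsto (0 : ℝ≥0∞)
      have h2 := hx.enorm
      rw [enorm_zero] at h2
      rw [ENNReal.zero_rpow_of_pos (by norm_num)] at h1
      exact h1.comp h2
  rw [lintegral_zero] at key
  have h1 := (ENNReal.continuous_rpow_const (y := (1 / 2 : ℝ))).tendsto (0 : ℝ≥0∞)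
  rw [ENNReal.zero_rpow_of_pos (by norm_num)] at h1
  refine (h1.comp key).congr fun n => ?_
  rw [eLpNorm_eq_lintegral_rpow_enorm_toReal (by norm_num) (by norm_num)]
  simp

theorem tendsto_eLpNorm_zero_of_le_mul {μ : Measure (Space d)} {h k : ℕ → Space d → ℝ} {M : ℝ}
    (hle : ∀ n, ∀ᵐ x ∂μ, ‖h n x‖ ≤ M * ‖k n x‖)
    (hk : Tendsto (fun n => eLpNorm (k n) 2 μ) atTop (𝓝 0)) :
    Tendsto (fun n => eLpNorm (h n) 2 μ) atTop (𝓝 0) := by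
  have h1 : Tendsto (fun n => ENNReal.ofReal M * eLpNorm (k n) 2 μ) atTop (𝓝 0) := by
    simpa using ENNReal.Tendsto.const_mul hk (Or.inr ENNReal.ofReal_ne_top)
  exact tendsto_of_tendsto_of_tendsto_of_le_of_le tendsto_const_nhds h1 (fun _ => zero_le)
    fun n => eLpNorm_le_mul_eLpNorm_of_ae_le_mul (hle n) 2

theorem tendsto_eLpNorm_zero_add {μ : Measure (Space d)} {h k : ℕ → Space d → ℝ}
    (hm : ∀ n, AEStronglyMeasurable (h n) μ) (km : ∀ n, AEStronglyMeasurable (k n) μ)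
    (hh : Tendsto (fun n => eLpNorm (h n) 2 μ) atTop (𝓝 0))
    (hk : Tendsto (fun n => eLpNorm (k n) 2 μ) atTop (𝓝 0)) :
    Tendsto (fun n => eLpNorm (h n + k n) 2 μ) atTop (𝓝 0) := by
  have h1 := hh.add hk
  rw [add_zero] at h1
  exact tendsto_of_tendsto_of_tendsto_of_le_of_le tendsto_const_nhds h1 (fun _ => zero_le)
    fun n => eLpNorm_add_le (hm n) (km n) (by norm_num)

theorem abs_sub_le_of_abs_deriv_le_one {β : ℝ → ℝ} (hβ : ContDiff ℝ (⊤ : ℕ∞) β)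
    (hβ1 : ∀ t, |deriv β t| ≤ 1) (s t : ℝ) : |β s - β t| ≤ |s - t| := by
  have h := Convex.norm_image_sub_le_of_norm_deriv_le (f := β) (s := Set.univ) (C := 1)
    (x := t) (y := s) (fun x _ => (hβ.differentiable (by simp)) x) (fun x _ => hβ1 x)
    convex_univ trivial trivial
  simpa using h

/-- Chain and product rule by approximation: if `ζ` is a test function and `β` is smooth with
`|β'| ≤ 1`, then `ζ β(u)` is a limit of test functions whose partial derivatives converge in `L²`
to the expected expressions. -/
theorem exists_testFunction_tendsto {Ω : TopologicalSpace.Opens (Space d)} {u : Space d → ℝ}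
    {g : Fin d → Space d → ℝ} (hu : MemLp u 2 (vol Ω)) (hg : ∀ i, MemLp (g i) 2 (vol Ω))
    (h : ∀ i, IsWeakPartial Ω i u (g i)) (ζ : 𝓓(Ω, ℝ)) {β : ℝ → ℝ}
    (hβ : ContDiff ℝ (⊤ : ℕ∞) β) (hβ1 : ∀ t, |deriv β t| ≤ 1) :
    ∃ φ : ℕ → 𝓓(Ω, ℝ),
      Tendsto (fun n => eLpNorm (fun x => φ n x - ζ x * β (u x)) 2 (vol Ω)) atTop (𝓝 0) ∧
      ∀ i, Tendsto (fun n => eLpNorm (fun x => partialDeriv i (φ n) x -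
        (ζ x * deriv β (u x) * g i x + partialDeriv i ζ x * β (u x))) 2 (vol Ω)) atTop (𝓝 0) := by
  obtain ⟨K, hKdef⟩ : ∃ K, K = tsupport ζ := ⟨_, rfl⟩
  have hK : IsCompact K := hKdef ▸ ζ.hasCompactSupport.isCompact
  have hKΩ : K ⊆ Ω := hKdef ▸ ζ.tsupport_subset
  have hKle : volume.restrict K ≤ vol Ω := Measure.restrict_mono hKΩ le_rfl
  obtain ⟨w, hwd, hwu, hwg, hae⟩ := exists_contDiff_tendsto hu hg h hK hKΩ
  have hζ0 : ∀ x, x ∉ K → ζ x = 0 := fun x hx => image_eq_zero_of_notMem_tsupport (hKdef ▸ hx)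
  have hζc : ∀ i, Continuous (partialDeriv i ζ) := fun i =>
    (ζ.contDiff.continuous_fderiv (by simp)).clm_apply continuous_const
  have hζd0 : ∀ i x, x ∉ K → partialDeriv i ζ x = 0 := by
    intro i x hx
    have : x ∉ tsupport (fderiv ℝ ζ) := fun h' => hx (hKdef ▸ tsupport_fderiv_subset ℝ h')
    rw [partialDeriv, image_eq_zero_of_notMem_tsupport this, zero_apply]
  -- all functions below vanish outside `K`
  have hred : ∀ {f : Space d → ℝ}, (∀ x, x ∉ K → f x = 0) →
      eLpNorm f 2 (vol Ω) = eLpNorm f 2 (volume.restrict K) := by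
    intro f hf
    rw [← vol_restrict_of_subset hK.measurableSet hKΩ]
    exact (eLpNorm_restrict_eq_of_support_subset
      (fun x hx => by_contra fun h' => hx (hf x h'))).symm
  obtain ⟨M, hM⟩ := ζ.continuous.bounded_above_of_compact_support ζ.hasCompactSupport
  have hφs : ∀ n, tsupport (fun x => ζ x * β (w n x)) ⊆ tsupport ζ := fun n =>
    tsupport_mul_subset_left
  let φ : ℕ → 𝓓(Ω, ℝ) := fun n => ⟨fun x => ζ x * β (w n x), ζ.contDiff.mul (hβ.comp (hwd n)),
    ζ.hasCompactSupport.mul_right, (hφs n).trans ζ.tsupport_subset⟩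
  have hβd : Differentiable ℝ β := hβ.differentiable (by simp)
  have hβ'c : Continuous (deriv β) := hβ.continuous_deriv (by simp)
  have hφd : ∀ n i x, partialDeriv i (φ n) x =
      ζ x * deriv β (w n x) * partialDeriv i (w n) x + partialDeriv i ζ x * β (w n x) := by
    intro n i x
    have h1 : HasFDerivAt ζ (fderiv ℝ ζ x) x :=
      (ζ.contDiff.differentiable (by simp) x).hasFDerivAt
    have h2 : HasFDerivAt (w n) (fderiv ℝ (w n) x) x :=
      ((hwd n).differentiable (by simp) x).hasFDerivAt
    have h3 := h1.mul ((hβd (w n x)).hasDerivAt.comp_hasFDerivAt x h2)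
    change fderiv ℝ (fun x => ζ x * β (w n x)) x _ = _
    have h4 : fderiv ℝ (fun x => ζ x * β (w n x)) x = _ := h3.fderiv
    rw [h4]
    simp [partialDeriv]
    ring
  have hum : AEStronglyMeasurable u (volume.restrict K) := hu.1.mono_measure hKle
  have hgm : ∀ i, AEStronglyMeasurable (g i) (volume.restrict K) :=
    fun i => (hg i).1.mono_measure hKle
  have hpm : ∀ n i, AEStronglyMeasurable (partialDeriv i (w n)) (volume.restrict K) := fun n i =>
    (((hwd n).continuous_fderiv (by simp)).clm_apply continuous_const).aestronglyMeasurable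
  have hwm : ∀ n, AEStronglyMeasurable (w n) (volume.restrict K) :=
    fun n => (hwd n).continuous.aestronglyMeasurable
  refine ⟨φ, ?_, fun i => ?_⟩
  · have : ∀ n, eLpNorm (fun x => φ n x - ζ x * β (u x)) 2 (vol Ω) =
        eLpNorm (fun x => φ n x - ζ x * β (u x)) 2 (volume.restrict K) := fun n =>
      hred fun x hx => by change ζ x * _ - _ = _; simp [hζ0 x hx]
    simp only [this]
    refine tendsto_eLpNorm_zero_of_le_mul (M := M) (fun n => Eventually.of_forall fun x => ?_) hwu
    change ‖ζ x * β (w n x) - _‖ ≤ _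
    rw [← mul_sub, norm_mul]
    exact mul_le_mul (hM x) (abs_sub_le_of_abs_deriv_le_one hβ hβ1 _ _) (norm_nonneg _)
      ((norm_nonneg _).trans (hM x))
  · obtain ⟨M', hM'⟩ := (hζc i).bounded_above_of_compact_support
      (HasCompactSupport.intro hK (hζd0 i))
    have : ∀ n, eLpNorm (fun x => partialDeriv i (φ n) x -
        (ζ x * deriv β (u x) * g i x + partialDeriv i ζ x * β (u x))) 2 (vol Ω) =
        eLpNorm (((fun x => ζ x * deriv β (w n x) * (partialDeriv i (w n) x - g i x)) +
          (fun x => ζ x * (deriv β (w n x) - deriv β (u x)) * g i x)) +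
          fun x => partialDeriv i ζ x * (β (w n x) - β (u x))) 2 (volume.restrict K) := by
      intro n
      rw [hred fun x hx => by simp [hφd, hζ0 x hx, hζd0 i x hx]]
      congr 1
      ext x
      simp only [hφd, Pi.add_apply]
      ring
    simp only [this]
    have hζm : AEStronglyMeasurable ζ (volume.restrict K) := ζ.continuous.aestronglyMeasurable
    have hζ'm : AEStronglyMeasurable (partialDeriv i ζ) (volume.restrict K) :=
      (hζc i).aestronglyMeasurable
    have hβum := hβ.continuous.comp_aestronglyMeasurable hum
    have hβ'um := hβ'c.comp_aestronglyMeasurable hum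
    have m1 : ∀ n, AEStronglyMeasurable (fun x => ζ x * deriv β (w n x) *
        (partialDeriv i (w n) x - g i x)) (volume.restrict K) := fun n =>
      (hζm.mul (hβ'c.comp_aestronglyMeasurable (hwm n))).mul ((hpm n i).sub (hgm i))
    have m2 : ∀ n, AEStronglyMeasurable (fun x => ζ x * (deriv β (w n x) - deriv β (u x)) *
        g i x) (volume.restrict K) := fun n =>
      (hζm.mul ((hβ'c.comp_aestronglyMeasurable (hwm n)).sub hβ'um)).mul (hgm i)
    have m3 : ∀ n, AEStronglyMeasurable (fun x => partialDeriv i ζ x * (β (w n x) - β (u x)))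
        (volume.restrict K) := fun n =>
      hζ'm.mul ((hβ.continuous.comp_aestronglyMeasurable (hwm n)).sub hβum)
    refine tendsto_eLpNorm_zero_add (fun n => (m1 n).add (m2 n)) m3
      (tendsto_eLpNorm_zero_add m1 m2 ?_ ?_) ?_
    · refine tendsto_eLpNorm_zero_of_le_mul (M := M) (fun n => Eventually.of_forall fun x => ?_)
        (hwg i)
      rw [norm_mul, norm_mul]
      gcongr
      calc ‖ζ x‖ * ‖deriv β (w n x)‖ ≤ ‖ζ x‖ * 1 := by gcongr; exact hβ1 _
        _ ≤ M := by simpa using hM x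
    · refine tendsto_eLpNorm_zero_of_dominated m2
        (((hg i).mono_measure hKle).const_mul (M * 2)) (fun n => Eventually.of_forall fun x => ?_) ?_
      · rw [norm_mul, norm_mul, norm_mul]
        have h0 : ‖deriv β (w n x) - deriv β (u x)‖ ≤ 2 := by
          refine (norm_sub_le _ _).trans ?_
          have h1 := hβ1 (w n x)
          have h2 := hβ1 (u x)
          simp only [Real.norm_eq_abs]
          linarith
        have hM0 : 0 ≤ M := (norm_nonneg _).trans (hM x)
        refine mul_le_mul_of_nonneg_right ?_ (norm_nonneg _)
        rw [Real.norm_of_nonneg (show 0 ≤ M * 2 by positivity)]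
        exact mul_le_mul (hM x) h0 (norm_nonneg _) hM0
      · filter_upwards [hae] with x hx
        have h1 : Tendsto (fun n => deriv β (w n x)) atTop (𝓝 (deriv β (u x))) :=
          (hβ'c.tendsto _).comp hx
        have h2 := ((h1.sub_const (deriv β (u x))).const_mul (ζ x)).mul_const (g i x)
        simpa using h2
    · refine tendsto_eLpNorm_zero_of_le_mul (M := M') (fun n => Eventually.of_forall fun x => ?_)
        hwu
      rw [norm_mul]
      exact mul_le_mul (hM' x) (abs_sub_le_of_abs_deriv_le_one hβ hβ1 _ _) (norm_nonneg _)
        ((norm_nonneg _).trans (hM' x))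

/-! ### Limits of test functions and the Sobolev inequality -/

theorem continuous_partialDeriv {Ω : TopologicalSpace.Opens (Space d)} (i : Fin d)
    (φ : 𝓓(Ω, ℝ)) : Continuous (partialDeriv i φ) :=
  (φ.contDiff.continuous_fderiv (by simp)).clm_apply continuous_const

theorem hasCompactSupport_partialDeriv {Ω : TopologicalSpace.Opens (Space d)} (i : Fin d)
    (φ : 𝓓(Ω, ℝ)) : HasCompactSupport (partialDeriv i φ) :=
  φ.hasCompactSupport.fderiv_apply ℝ _

theorem memLp_testFunction {Ω : TopologicalSpace.Opens (Space d)} (φ : 𝓓(Ω, ℝ)) :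
    MemLp φ 2 (vol Ω) :=
  (φ.continuous.memLp_of_hasCompactSupport φ.hasCompactSupport (μ := volume)).restrict _

theorem memLp_partialDeriv {Ω : TopologicalSpace.Opens (Space d)} (i : Fin d) (φ : 𝓓(Ω, ℝ)) :
    MemLp (partialDeriv i φ) 2 (vol Ω) :=
  ((continuous_partialDeriv i φ).memLp_of_hasCompactSupport
    (hasCompactSupport_partialDeriv i φ) (μ := volume)).restrict _

theorem memLp_of_tendsto {μ : Measure (Space d)} {h : ℕ → Space d → ℝ} {f : Space d → ℝ}
    (hh : ∀ n, MemLp (h n) 2 μ) (hf : AEStronglyMeasurable f μ)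
    (hlim : Tendsto (fun n => eLpNorm (fun x => h n x - f x) 2 μ) atTop (𝓝 0)) :
    MemLp f 2 μ := by
  obtain ⟨n, hn⟩ := (hlim.eventually_lt_const (u := ∞) (by simp)).exists
  have h1 : MemLp (fun x => h n x - f x) 2 μ := ⟨(hh n).1.sub hf, hn⟩
  have h2 : f = h n - fun x => h n x - f x := by ext x; simp
  rw [h2]
  exact (hh n).sub h1

theorem tendsto_integral_mul {μ : Measure (Space d)} {h : ℕ → Space d → ℝ} {f ψ : Space d → ℝ}
    (hh : ∀ n, MemLp (h n) 2 μ) (hf : MemLp f 2 μ) (hψ : MemLp ψ 2 μ)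
    (hlim : Tendsto (fun n => eLpNorm (fun x => h n x - f x) 2 μ) atTop (𝓝 0)) :
    Tendsto (fun n => ∫ x, h n x * ψ x ∂μ) atTop (𝓝 (∫ x, f x * ψ x ∂μ)) := by
  refine tendsto_integral_of_L1' _ (hf.integrable_mul hψ).1
    (Eventually.of_forall fun n => (hh n).integrable_mul hψ) ?_
  have h1 : Tendsto (fun n => eLpNorm (fun x => h n x - f x) 2 μ * eLpNorm ψ 2 μ) atTop (𝓝 0) := by
    simpa using ENNReal.Tendsto.mul_const hlim (Or.inr hψ.2.ne)
  refine tendsto_of_tendsto_of_tendsto_of_le_of_le tendsto_const_nhds h1 (fun _ => zero_le)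
    fun n => ?_
  have h2 := eLpNorm_smul_le_mul_eLpNorm (p := 2) (q := 2) (r := 1) hψ.1 ((hh n).sub hf).1
  refine le_trans (le_of_eq (congrArg (fun k => eLpNorm k 1 μ) ?_)) h2
  ext x
  simp [sub_mul]

/-- An `L²` limit of test functions whose partial derivatives converge in `L²` is in
`W^{1,2}_0(Ω)`, and its weak partial derivatives are the limits of the partial derivatives. -/
theorem memW120_of_tendsto {Ω : TopologicalSpace.Opens (Space d)} {φ : ℕ → 𝓓(Ω, ℝ)}
    {f : Space d → ℝ} {g : Fin d → Space d → ℝ} (hf : AEStronglyMeasurable f (vol Ω))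
    (hg : ∀ i, AEStronglyMeasurable (g i) (vol Ω))
    (hφf : Tendsto (fun n => eLpNorm (fun x => φ n x - f x) 2 (vol Ω)) atTop (𝓝 0))
    (hφg : ∀ i, Tendsto (fun n => eLpNorm (fun x => partialDeriv i (φ n) x - g i x) 2 (vol Ω))
      atTop (𝓝 0)) :
    MemW120 Ω f ∧ ∀ i, IsWeakPartial Ω i f (g i) := by
  have hfL : MemLp f 2 (vol Ω) := memLp_of_tendsto (fun n => memLp_testFunction (φ n)) hf hφf
  have hgL : ∀ i, MemLp (g i) 2 (vol Ω) := fun i =>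
    memLp_of_tendsto (fun n => memLp_partialDeriv i (φ n)) (hg i) (hφg i)
  have hloc : ∀ {k : Space d → ℝ}, MemLp k 2 (vol Ω) →
      LocallyIntegrableOn k (Ω : Set (Space d)) volume := fun hk =>
    locallyIntegrableOn_of_locallyIntegrable_restrict (hk.locallyIntegrable (by norm_num))
  have hw : ∀ i, IsWeakPartial Ω i f (g i) := by
    intro i
    refine ⟨hloc hfL, hloc (hgL i), fun ψ => ?_⟩
    have hred : ∀ k : Space d → ℝ, (∀ x, x ∉ tsupport ψ → k x = 0) →
        ∫ x, k x ∂(vol Ω) = ∫ x, k x := fun k hk =>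
      setIntegral_eq_integral_of_forall_compl_eq_zero fun x hx =>
        hk x fun h' => hx (ψ.tsupport_subset h')
    have hibp : ∀ n, ∫ x, φ n x * partialDeriv i ψ x ∂(vol Ω) =
        - ∫ x, partialDeriv i (φ n) x * ψ x ∂(vol Ω) := by
      intro n
      rw [hred _ fun x hx => ?_, hred _ fun x hx => ?_]
      · refine integral_mul_fderiv_eq_neg_fderiv_mul_of_integrable ?_ ?_ ?_
          (fun x _ => (φ n).contDiff.differentiable (by simp) x)
          (fun x _ => ψ.contDiff.differentiable (by simp) x)
        · exact ((continuous_partialDeriv i (φ n)).mul ψ.continuous).integrable_of_hasCompactSupport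
            (ψ.hasCompactSupport.mul_left)
        · exact ((φ n).continuous.mul
            (continuous_partialDeriv i ψ)).integrable_of_hasCompactSupport
            ((φ n).hasCompactSupport.mul_right)
        · exact ((φ n).continuous.mul ψ.continuous).integrable_of_hasCompactSupport
            (ψ.hasCompactSupport.mul_left)
      · rw [image_eq_zero_of_notMem_tsupport hx, mul_zero]
      · have : x ∉ tsupport (fderiv ℝ ψ) := fun h' => hx (tsupport_fderiv_subset ℝ h')
        rw [partialDeriv, image_eq_zero_of_notMem_tsupport this, zero_apply, mul_zero]
    have l1 := tendsto_integral_mul (fun n => memLp_testFunction (φ n)) hfL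
      (memLp_partialDeriv i ψ) hφf
    have l2 := (tendsto_integral_mul (fun n => memLp_partialDeriv i (φ n)) (hgL i)
      (memLp_testFunction ψ) (hφg i)).neg
    simp only [hibp] at l1
    exact tendsto_nhds_unique l1 l2
  refine ⟨⟨⟨hfL, fun i => ⟨g i, hw i, hgL i⟩⟩, φ, hφf, fun i => ?_⟩, hw⟩
  refine (hφg i).congr fun n => eLpNorm_congr_ae ?_
  filter_upwards [(hw i).ae_eq_weakPartial] with x hx
  rw [hx]

theorem toReal_eLpNorm_two_sq {μ : Measure (Space d)} {f : Space d → ℝ} (hf : MemLp f 2 μ) :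
    (eLpNorm f 2 μ).toReal ^ 2 = ∫ x, f x ^ 2 ∂μ := by
  have h0 : 0 ≤ ∫ x, ‖f x‖ ^ (2 : ℝ) ∂μ := integral_nonneg fun x => by positivity
  rw [hf.eLpNorm_eq_integral_rpow_norm (by norm_num) (by norm_num), ENNReal.toReal_ofReal
    (by simp only [ENNReal.toReal_ofNat]; positivity)]
  simp only [ENNReal.toReal_ofNat]
  rw [← Real.rpow_natCast, ← Real.rpow_mul h0]
  simp

theorem norm_fderiv_le_sum (f : Space d → ℝ) (x : Space d) :
    ‖fderiv ℝ f x‖ ≤ ∑ i, ‖partialDeriv i f x‖ := by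
  refine ContinuousLinearMap.opNorm_le_bound _ (by positivity) fun v => ?_
  have hv : v = ∑ i, v i • (EuclideanSpace.single i 1 : Space d) := by
    ext j
    simp [Pi.single_apply]
  have h1 : fderiv ℝ f x v = ∑ i, v i * partialDeriv i f x := by
    conv_lhs => rw [hv]
    simp [partialDeriv]
  rw [h1, Finset.sum_mul]
  refine (norm_sum_le _ _).trans (Finset.sum_le_sum fun i _ => ?_)
  rw [norm_mul, mul_comm]
  exact mul_le_mul_of_nonneg_left (PiLp.norm_apply_le v i) (norm_nonneg _)

/-- The Sobolev inequality for test functions, combined with Hölder's inequality on a set `E` of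
finite measure. -/
theorem eLpNorm_restrict_le_of_testFunction (hd : 3 ≤ d) {Ω : TopologicalSpace.Opens (Space d)}
    (φ : 𝓓(Ω, ℝ)) {E : Set (Space d)} :
    eLpNorm φ 2 (volume.restrict E) ≤
      (SNormLESNormFDerivOfEqConst ℝ (volume : Measure (Space d)) 2 : ℝ≥0∞) *
        volume E ^ (1 / (d : ℝ)) * ∑ i, eLpNorm (partialDeriv i φ) 2 (vol Ω) := by
  have hd' : (3 : ℝ) ≤ d := by exact_mod_cast hd
  obtain ⟨q, hq⟩ : ∃ q : NNReal, (q : ℝ) = 2 * d / (d - 2) :=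
    ⟨⟨2 * d / (d - 2), div_nonneg (by positivity) (by linarith)⟩, rfl⟩
  have hqinv : (q : ℝ)⁻¹ = 1 / 2 - 1 / d := by
    rw [hq]
    have : (d : ℝ) - 2 ≠ 0 := by linarith
    field_simp
  have hq2 : (2 : ℝ) ≤ q := by
    rw [hq, le_div_iff₀ (by linarith)]; linarith
  have h1 := eLpNorm_le_eLpNorm_fderiv_of_eq (volume : Measure (Space d)) (u := φ) (p := 2)
    (p' := q) (φ.contDiff.of_le (by simp)) φ.hasCompactSupport (by norm_num)
    (by simp; omega) (by simp [hqinv])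
  simp only [NNReal.coe_ofNat, ENNReal.coe_ofNat] at h1
  have h2 : eLpNorm φ 2 (volume.restrict E) ≤
      eLpNorm φ q (volume.restrict E) * volume E ^ (1 / (d : ℝ)) := by
    have h := eLpNorm_le_eLpNorm_mul_rpow_measure_univ (μ := volume.restrict E) (p := 2)
      (q := (q : ℝ≥0∞)) (f := φ) (by exact_mod_cast hq2) φ.continuous.aestronglyMeasurable
    rw [Measure.restrict_apply_univ] at h
    have e : 1 / (2 : ℝ≥0∞).toReal - 1 / (q : ℝ≥0∞).toReal = 1 / (d : ℝ) := by
      simp [hqinv]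
    rwa [e] at h
  have h3 : eLpNorm (fderiv ℝ φ) 2 volume ≤ ∑ i, eLpNorm (partialDeriv i φ) 2 volume := by
    have hm : ∀ i, AEStronglyMeasurable (fun x => ‖partialDeriv i φ x‖) volume := fun i =>
      (continuous_partialDeriv i φ).norm.aestronglyMeasurable
    calc _ ≤ eLpNorm (∑ i, fun x => ‖partialDeriv i φ x‖) 2 volume := by
          refine eLpNorm_mono_real fun x => ?_
          rw [Finset.sum_apply]
          exact norm_fderiv_le_sum φ x
      _ ≤ ∑ i, eLpNorm (fun x => ‖partialDeriv i φ x‖) 2 volume :=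
          eLpNorm_sum_le (fun i _ => hm i) (by norm_num)
      _ = _ := by simp only [eLpNorm_norm]
  have h4 : ∀ i, eLpNorm (partialDeriv i φ) 2 volume = eLpNorm (partialDeriv i φ) 2 (vol Ω) := by
    intro i
    refine (eLpNorm_restrict_eq_of_support_subset fun x hx => ?_).symm
    by_contra h'
    have : x ∉ tsupport (fderiv ℝ φ) :=
      fun h'' => h' (φ.tsupport_subset (tsupport_fderiv_subset ℝ h''))
    exact hx (by rw [partialDeriv, image_eq_zero_of_notMem_tsupport this, zero_apply])
  simp only [h4] at h3
  calc _ ≤ eLpNorm φ q volume * volume E ^ (1 / (d : ℝ)) :=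
        h2.trans (by gcongr; exact Measure.restrict_le_self)
    _ ≤ (_ * ∑ i, eLpNorm (partialDeriv i φ) 2 (vol Ω)) * volume E ^ (1 / (d : ℝ)) := by
        gcongr
        exact h1.trans (by gcongr)
    _ = _ := by ring

/-- The Sobolev inequality on a set `E` of finite measure, for `L²` limits of test functions. -/
theorem exists_sobolev_const (hd : 3 ≤ d) : ∃ S : ℝ, 0 < S ∧
    ∀ (Ω : TopologicalSpace.Opens (Space d)) (φ : ℕ → 𝓓(Ω, ℝ)) (f : Space d → ℝ)
      (g : Fin d → Space d → ℝ), AEStronglyMeasurable f (vol Ω) →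
      (∀ i, AEStronglyMeasurable (g i) (vol Ω)) →
      Tendsto (fun n => eLpNorm (fun x => φ n x - f x) 2 (vol Ω)) atTop (𝓝 0) →
      (∀ i, Tendsto (fun n => eLpNorm (fun x => partialDeriv i (φ n) x - g i x) 2 (vol Ω))
        atTop (𝓝 0)) →
      ∀ E ⊆ (Ω : Set (Space d)), volume E ≠ ∞ →
        ∫ x in E, f x ^ 2 ≤ S * volume.real E ^ (2 / (d : ℝ)) * ∫ x, ∑ i, g i x ^ 2 ∂(vol Ω) := by
  obtain ⟨c, hc⟩ : ∃ c, c = SNormLESNormFDerivOfEqConst ℝ (volume : Measure (Space d)) 2 :=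
    ⟨_, rfl⟩
  have hd0 : (0 : ℝ) < d := by exact_mod_cast (by omega : 0 < d)
  refine ⟨(c ^ 2 + 1) * d, by positivity, fun Ω φ f g hf hg hφf hφg E hE hEfin => ?_⟩
  have hfL : MemLp f 2 (vol Ω) := memLp_of_tendsto (fun n => memLp_testFunction (φ n)) hf hφf
  have hgL : ∀ i, MemLp (g i) 2 (vol Ω) := fun i =>
    memLp_of_tendsto (fun n => memLp_partialDeriv i (φ n)) (hg i) (hφg i)
  have hle : volume.restrict E ≤ vol Ω := Measure.restrict_mono hE le_rfl
  have hfE : MemLp f 2 (volume.restrict E) := hfL.mono_measure hle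
  have hVfin : volume E ^ (1 / (d : ℝ)) ≠ ∞ :=
    ENNReal.rpow_ne_top_of_nonneg (by positivity) hEfin
  -- the inequality for norms, by passing to the limit
  have key : eLpNorm f 2 (volume.restrict E) ≤
      c * volume E ^ (1 / (d : ℝ)) * ∑ i, eLpNorm (g i) 2 (vol Ω) := by
    have hlim : Tendsto (fun n => eLpNorm (fun x => φ n x - f x) 2 (vol Ω) +
        c * volume E ^ (1 / (d : ℝ)) * ∑ i, (eLpNorm (fun x => partialDeriv i (φ n) x - g i x) 2
          (vol Ω) + eLpNorm (g i) 2 (vol Ω))) atTop (𝓝 (0 + c * volume E ^ (1 / (d : ℝ)) *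
          ∑ i, (0 + eLpNorm (g i) 2 (vol Ω)))) := by
      refine hφf.add (ENNReal.Tendsto.const_mul (tendsto_finsetSum _ fun i _ =>
        (hφg i).add tendsto_const_nhds) (Or.inr (ENNReal.mul_ne_top (by simp) hVfin)))
    simp only [zero_add] at hlim
    refine ge_of_tendsto' hlim fun n => ?_
    have hφm : AEStronglyMeasurable (φ n) (volume.restrict E) :=
      (φ n).continuous.aestronglyMeasurable
    calc eLpNorm f 2 (volume.restrict E)
        = eLpNorm ((f - ⇑(φ n)) + ⇑(φ n)) 2 (volume.restrict E) := by rw [sub_add_cancel]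
      _ ≤ eLpNorm (f - ⇑(φ n)) 2 (volume.restrict E) + eLpNorm (φ n) 2 (volume.restrict E) :=
          eLpNorm_add_le (hfE.1.sub hφm) hφm (by norm_num)
      _ ≤ _ := by
          refine add_le_add ?_ ?_
          · rw [eLpNorm_sub_comm]
            exact eLpNorm_mono_measure _ hle
          · refine (eLpNorm_restrict_le_of_testFunction hd (φ n)).trans ?_
            rw [← hc]
            gcongr with i
            calc eLpNorm (partialDeriv i (φ n)) 2 (vol Ω)
                = eLpNorm ((partialDeriv i (φ n) - g i) + g i) 2 (vol Ω) := by
                  rw [sub_add_cancel]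
              _ ≤ _ := eLpNorm_add_le ((memLp_partialDeriv i (φ n)).1.sub (hg i)) (hg i)
                  (by norm_num)
  have hsumfin : ∑ i, eLpNorm (g i) 2 (vol Ω) ≠ ∞ :=
    ENNReal.sum_ne_top.2 fun i _ => (hgL i).2.ne
  have key' := ENNReal.toReal_mono
    (ENNReal.mul_ne_top (ENNReal.mul_ne_top (by simp) hVfin) hsumfin) key
  rw [ENNReal.toReal_mul, ENNReal.toReal_mul, ENNReal.coe_toReal,
    ENNReal.toReal_sum fun i _ => (hgL i).2.ne, ← ENNReal.toReal_rpow] at key'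
  rw [← toReal_eLpNorm_two_sq hfE, integral_finsetSum _ fun i _ => (hgL i).integrable_sq]
  simp only [← toReal_eLpNorm_two_sq (hgL _)]
  have hcs := sq_sum_le_card_mul_sum_sq (s := Finset.univ)
    (f := fun i => (eLpNorm (g i) 2 (vol Ω)).toReal)
  rw [Finset.card_univ, Fintype.card_fin] at hcs
  have hV : volume.real E ^ (2 / (d : ℝ)) = ((volume E).toReal ^ (1 / (d : ℝ))) ^ 2 := by
    rw [Measure.real, ← Real.rpow_natCast, ← Real.rpow_mul ENNReal.toReal_nonneg]
    congr 1
    push_cast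
    ring
  rw [hV]
  set V := (volume E).toReal ^ (1 / (d : ℝ))
  calc _ ≤ (c * V * ∑ i, (eLpNorm (g i) 2 (vol Ω)).toReal) ^ 2 := by gcongr
    _ = c ^ 2 * V ^ 2 * (∑ i, (eLpNorm (g i) 2 (vol Ω)).toReal) ^ 2 := by ring
    _ ≤ (c ^ 2 + 1) * V ^ 2 * (d * ∑ i, (eLpNorm (g i) 2 (vol Ω)).toReal ^ 2) := by
        gcongr
        linarith
    _ = _ := by ring

/-! ### The smooth positive part and the algebra of elliptic matrices -/

/-- The smooth convex approximation `β(t) = (t + √(t² + δ²)) / 2` of the positive part of `t`.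
It satisfies `β' = β / √(t² + δ²)`, so that the quotient `β² / β'`, which the Caccioppoli inequality
puts in place of `t₊²`, is at most `t₊² + δ²`. -/
noncomputable def softPos (δ t : ℝ) : ℝ := (t + √(t ^ 2 + δ ^ 2)) / 2

theorem sqrt_sq_add_sq_pos {δ : ℝ} (hδ : 0 < δ) (t : ℝ) : 0 < √(t ^ 2 + δ ^ 2) :=
  Real.sqrt_pos.2 (by positivity)

theorem abs_lt_sqrt_sq_add_sq {δ : ℝ} (hδ : 0 < δ) (t : ℝ) : |t| < √(t ^ 2 + δ ^ 2) := by
  rw [← Real.sqrt_sq_eq_abs]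
  exact Real.sqrt_lt_sqrt (sq_nonneg t) (by nlinarith)

theorem softPos_pos {δ : ℝ} (hδ : 0 < δ) (t : ℝ) : 0 < softPos δ t := by
  have := (abs_lt.1 (abs_lt_sqrt_sq_add_sq hδ t)).1
  unfold softPos; linarith

theorem max_le_softPos {δ : ℝ} (hδ : 0 < δ) (t : ℝ) : max t 0 ≤ softPos δ t := by
  have h1 := (abs_lt.1 (abs_lt_sqrt_sq_add_sq hδ t)).2
  exact max_le (by unfold softPos; linarith) (softPos_pos hδ t).le

theorem softPos_le_sqrt {δ : ℝ} (hδ : 0 < δ) (t : ℝ) : softPos δ t ≤ √(t ^ 2 + δ ^ 2) := by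
  have h1 := (abs_lt.1 (abs_lt_sqrt_sq_add_sq hδ t)).2
  unfold softPos; linarith

theorem softPos_mul_sqrt_le {δ : ℝ} (hδ : 0 < δ) (t : ℝ) :
    softPos δ t * √(t ^ 2 + δ ^ 2) ≤ max t 0 ^ 2 + δ ^ 2 := by
  have h1 := abs_lt.1 (abs_lt_sqrt_sq_add_sq hδ t)
  have h2 : √(t ^ 2 + δ ^ 2) ^ 2 = t ^ 2 + δ ^ 2 := Real.sq_sqrt (by positivity)
  unfold softPos
  rcases le_total 0 t with ht | ht
  · rw [max_eq_left ht]
    nlinarith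
  · rw [max_eq_right ht]
    nlinarith

theorem contDiff_softPos {δ : ℝ} (hδ : 0 < δ) : ContDiff ℝ (⊤ : ℕ∞) (softPos δ) := by
  unfold softPos
  refine ContDiff.div_const (contDiff_id.add (ContDiff.sqrt (by fun_prop) fun t => ?_)) 2
  positivity

theorem hasDerivAt_softPos {δ : ℝ} (hδ : 0 < δ) (t : ℝ) :
    HasDerivAt (softPos δ) (softPos δ t / √(t ^ 2 + δ ^ 2)) t := by
  have h1 : HasDerivAt (fun t : ℝ => t ^ 2 + δ ^ 2) (2 * t) t := by
    simpa using (hasDerivAt_pow 2 t).add_const (δ ^ 2)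
  have h2 := ((hasDerivAt_id t).add (h1.sqrt (by positivity))).div_const 2
  refine h2.congr_deriv ?_
  have h3 := (sqrt_sq_add_sq_pos hδ t).ne'
  unfold softPos
  field_simp
  ring

/-- The lower bound on the inverse matrix, applied to `ξ = A p`, bounds the flux `A p` by the
energy. -/
theorem norm_toEuclideanLin_sq_le {A : Matrix (Fin d) (Fin d) ℝ} {lam Lam : ℝ} (hlam : 0 < lam)
    (hLam : 0 < Lam) (hA : ∀ ξ : Space d,
      lam * ‖ξ‖ ^ 2 ≤ inner ℝ ξ (Matrix.toEuclideanLin A ξ) ∧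
      Lam⁻¹ * ‖ξ‖ ^ 2 ≤ inner ℝ ξ (Matrix.toEuclideanLin A⁻¹ ξ)) (p : Space d) :
    ‖Matrix.toEuclideanLin A p‖ ^ 2 ≤ Lam * inner ℝ p (Matrix.toEuclideanLin A p) := by
  have hdet : IsUnit A.det := by
    rw [isUnit_iff_ne_zero]
    intro h0
    obtain ⟨v, hv0, hv⟩ := Matrix.exists_mulVec_eq_zero_iff.2 h0
    have h1 := (hA (WithLp.toLp 2 v)).1
    rw [Matrix.toLpLin_toLp, Matrix.toLin'_apply, hv] at h1
    simp only [WithLp.toLp_zero, inner_zero_right] at h1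
    have h2 : ‖(WithLp.toLp 2 v : Space d)‖ ^ 2 = 0 :=
      le_antisymm (by nlinarith) (by positivity)
    have h3 : (WithLp.toLp 2 v : Space d) = 0 := by simpa using h2
    exact hv0 (by simpa using h3)
  have h1 := (hA (Matrix.toEuclideanLin A p)).2
  have h2 : Matrix.toEuclideanLin A⁻¹ (Matrix.toEuclideanLin A p) = p := by
    ext i
    simp [Matrix.toLpLin_apply, Matrix.nonsing_inv_mul A hdet]
  rw [h2, real_inner_comm, inv_mul_le_iff₀ hLam] at h1
  exact h1

/-- The algebra behind the Caccioppoli inequality. With `p = ∇u`, `q = ∇η`, `s = η`, `v = β(u)`,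
`b = β'(u)`, the left side is `|∇(η β(u))|²` and the first term on the right is, up to a factor,
`∇(η² β(u)) · a ∇u`. Weighting Young's inequality by `b = v / r` lets the term quadratic in `∇u`
absorb the mixed one. -/
theorem norm_sq_le_of_elliptic {A : Matrix (Fin d) (Fin d) ℝ} {lam Lam : ℝ} (hlam : 0 < lam)
    (hlL : lam ≤ Lam) (hA : ∀ ξ : Space d,
      lam * ‖ξ‖ ^ 2 ≤ inner ℝ ξ (Matrix.toEuclideanLin A ξ) ∧
      Lam⁻¹ * ‖ξ‖ ^ 2 ≤ inner ℝ ξ (Matrix.toEuclideanLin A⁻¹ ξ)) (p q : Space d)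
    {s b v r : ℝ} (hb0 : 0 ≤ b) (hb1 : b ≤ 1) (hr : 0 < r) (hv : v = b * r) :
    ‖(s * b) • p + v • q‖ ^ 2 ≤
      4 / lam * inner ℝ ((s ^ 2 * b) • p + (2 * s * v) • q) (Matrix.toEuclideanLin A p) +
        10 * (Lam / lam) * (‖q‖ ^ 2 * (v * r)) := by
  have hLam : 0 < Lam := hlam.trans_le hlL
  have hN := norm_toEuclideanLin_sq_le hlam hLam hA p
  have hQ := (hA p).1
  set N := Matrix.toEuclideanLin A p
  set Q := inner ℝ p N
  have hcs : |inner ℝ q N| ≤ ‖q‖ * ‖N‖ := abs_real_inner_le_norm q N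
  have hinner : inner ℝ ((s ^ 2 * b) • p + (2 * s * v) • q) N =
      s ^ 2 * b * Q + 2 * s * v * inner ℝ q N := by
    simp [inner_add_left, inner_smul_left, Q]
  -- Young's inequality for the mixed term
  have hyoung : 2 * s * r * inner ℝ q N ≥ -(s ^ 2 * Q / 2) - 2 * Lam * r ^ 2 * ‖q‖ ^ 2 := by
    have h1 : |s * r * inner ℝ q N| ≤ |s| * r * (‖q‖ * ‖N‖) := by
      rw [abs_mul, abs_mul, abs_of_pos hr]
      gcongr
    have h2 : 0 ≤ (|s| * ‖N‖ - 2 * Lam * r * ‖q‖) ^ 2 := sq_nonneg _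
    have h3 : s ^ 2 * ‖N‖ ^ 2 ≤ s ^ 2 * (Lam * Q) := by gcongr
    have h4 : 4 * Lam * (|s| * r * (‖q‖ * ‖N‖)) ≤
        Lam * (s ^ 2 * Q + 4 * Lam * r ^ 2 * ‖q‖ ^ 2) := by
      nlinarith [sq_abs s]
    have h5 : 4 * (|s| * r * (‖q‖ * ‖N‖)) ≤ s ^ 2 * Q + 4 * Lam * r ^ 2 * ‖q‖ ^ 2 := by
      refine le_of_mul_le_mul_left ?_ hLam
      linarith
    have h6 := neg_abs_le (s * r * inner ℝ q N)
    linarith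
  have hlow : s ^ 2 * b * Q / 2 - 2 * Lam * (‖q‖ ^ 2 * (v * r)) ≤
      s ^ 2 * b * Q + 2 * s * v * inner ℝ q N := by
    have h1 := mul_le_mul_of_nonneg_left hyoung hb0
    rw [hv]
    linarith
  have htri : ‖(s * b) • p + v • q‖ ^ 2 ≤ 2 * (s ^ 2 * b * ‖p‖ ^ 2) + 2 * (‖q‖ ^ 2 * (v * r)) := by
    have h1 : ‖(s * b) • p + v • q‖ ≤ |s * b| * ‖p‖ + |v| * ‖q‖ := by
      refine (norm_add_le _ _).trans (le_of_eq ?_)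
      rw [norm_smul, norm_smul, Real.norm_eq_abs, Real.norm_eq_abs]
    have h2 : ‖(s * b) • p + v • q‖ ^ 2 ≤ (|s * b| * ‖p‖ + |v| * ‖q‖) ^ 2 := by gcongr
    have h3 : (|s * b| * ‖p‖ + |v| * ‖q‖) ^ 2 ≤
        2 * ((s * b) ^ 2 * ‖p‖ ^ 2) + 2 * (v ^ 2 * ‖q‖ ^ 2) := by
      rw [← sq_abs (s * b), ← sq_abs v]
      nlinarith [sq_nonneg (|s * b| * ‖p‖ - |v| * ‖q‖)]
    have h4 : (s * b) ^ 2 * ‖p‖ ^ 2 ≤ s ^ 2 * b * ‖p‖ ^ 2 := by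
      rw [mul_pow]
      gcongr
      nlinarith
    have h5 : v ^ 2 * ‖q‖ ^ 2 ≤ ‖q‖ ^ 2 * (v * r) := by
      have : v ^ 2 ≤ v * r := by
        rw [hv]; nlinarith [mul_nonneg hb0 (sq_nonneg r)]
      rw [mul_comm]
      gcongr
    linarith
  have hvr : 0 ≤ ‖q‖ ^ 2 * (v * r) := by rw [hv]; positivity
  have hp : s ^ 2 * b * (lam * ‖p‖ ^ 2) ≤ s ^ 2 * b * Q := by gcongr
  rw [hinner]
  refine htri.trans (le_of_mul_le_mul_left ?_ hlam)
  have e : lam * (4 / lam * (s ^ 2 * b * Q + 2 * s * v * inner ℝ q N) +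
      10 * (Lam / lam) * (‖q‖ ^ 2 * (v * r))) =
      4 * (s ^ 2 * b * Q + 2 * s * v * inner ℝ q N) + 10 * Lam * (‖q‖ ^ 2 * (v * r)) := by
    field_simp
  rw [e]
  nlinarith [mul_le_mul_of_nonneg_right hlL hvr]

/-! ### The Caccioppoli inequality -/

theorem partialDeriv_sq {Ω : TopologicalSpace.Opens (Space d)} (η : 𝓓(Ω, ℝ)) (i : Fin d)
    (x : Space d) : partialDeriv i (fun x => η x ^ 2) x = 2 * η x * partialDeriv i η x := by
  have h1 : HasFDerivAt η (fderiv ℝ η x) x :=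
    (η.contDiff.differentiable (by simp) x).hasFDerivAt
  rw [partialDeriv, (h1.pow 2).fderiv]
  simp [partialDeriv]

theorem memLp_bounded_mul {μ : Measure (Space d)} {h f : Space d → ℝ} {M : ℝ}
    (hh : AEStronglyMeasurable h μ) (hM : ∀ x, ‖h x‖ ≤ M) (hf : MemLp f 2 μ) :
    MemLp (fun x => h x * f x) 2 μ := by
  refine hf.of_le_mul (c := M) (hh.mul hf.1) (Eventually.of_forall fun x => ?_)
  rw [norm_mul]
  exact mul_le_mul_of_nonneg_right (hM x) (norm_nonneg _)

theorem memLp_max_sub {μ : Measure (Space d)} {u : Space d → ℝ} (hu : MemLp u 2 μ) {k : ℝ}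
    (hk : 0 ≤ k) : MemLp (fun x => max (u x - k) 0) 2 μ := by
  refine hu.mono (((continuous_id.sub continuous_const).max
    continuous_const).comp_aestronglyMeasurable hu.1) (Eventually.of_forall fun x => ?_)
  rw [Real.norm_of_nonneg (le_max_right _ _), Real.norm_eq_abs]
  exact max_le ((sub_le_self _ hk).trans (le_abs_self _)) (abs_nonneg _)

/-- The `i`-th component of the flux `a ∇u` is square integrable. -/
theorem memLp_flux {Ω : TopologicalSpace.Opens (Space d)}
    {a : Space d → Matrix (Fin d) (Fin d) ℝ} {lam Lam : ℝ} (ha : IsElliptic Ω a lam Lam)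
    {p : Space d → Space d} (hp : ∀ i, MemLp (fun x => p x i) 2 (vol Ω)) (i : Fin d) :
    MemLp (fun x => Matrix.toEuclideanLin (a x) (p x) i) 2 (vol Ω) := by
  have hLam : 0 < Lam := ha.lam_pos.trans_le ha.lam_le
  have hsum : MemLp (fun x => ∑ j, ‖p x j‖) 2 (vol Ω) :=
    memLp_finsetSum _ fun j _ => (hp j).norm
  have hmeas : AEStronglyMeasurable (fun x => Matrix.toEuclideanLin (a x) (p x) i) (vol Ω) := by
    have e : (fun x => Matrix.toEuclideanLin (a x) (p x) i) = fun x => ∑ j, a x i j * p x j := by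
      ext x
      simp [Matrix.toLpLin_apply, Matrix.mulVec, dotProduct]
    rw [e]
    exact Finset.aestronglyMeasurable_fun_sum _ fun j _ =>
      (ha.measurable i j).aestronglyMeasurable.mul (hp j).1
  refine hsum.of_le_mul (c := Lam) hmeas ?_
  filter_upwards [ha.coercive] with x hx
  have h1 := norm_toEuclideanLin_sq_le ha.lam_pos hLam hx (p x)
  have h2 : ‖Matrix.toEuclideanLin (a x) (p x)‖ ≤ Lam * ‖p x‖ := by
    set N := Matrix.toEuclideanLin (a x) (p x)
    have h3 : ‖N‖ ^ 2 ≤ Lam * (‖p x‖ * ‖N‖) :=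
      h1.trans (mul_le_mul_of_nonneg_left (real_inner_le_norm _ _) hLam.le)
    by_cases h0 : ‖N‖ = 0
    · rw [h0]; positivity
    · have h4 : 0 < ‖N‖ := lt_of_le_of_ne (norm_nonneg _) (Ne.symm h0)
      nlinarith
  have h5 : ‖p x‖ ≤ ∑ j, ‖p x j‖ := by
    rw [EuclideanSpace.norm_eq]
    refine Real.sqrt_le_iff.2 ⟨by positivity, ?_⟩
    exact Finset.sum_sq_le_sq_sum_of_nonneg fun j _ => norm_nonneg _
  rw [Real.norm_of_nonneg (show 0 ≤ ∑ j, ‖p x j‖ by positivity)]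
  exact (PiLp.norm_apply_le _ i).trans (h2.trans (mul_le_mul_of_nonneg_left h5 hLam.le))

theorem softPos_sub_deriv {δ : ℝ} (hδ : 0 < δ) (k t : ℝ) :
    deriv (fun t => softPos δ (t - k)) t = softPos δ (t - k) / √((t - k) ^ 2 + δ ^ 2) := by
  have h := (hasDerivAt_softPos hδ (t - k)).comp t ((hasDerivAt_id t).sub_const k)
  rw [mul_one] at h
  exact h.deriv

theorem softPos_sub_deriv_nonneg {δ : ℝ} (hδ : 0 < δ) (k t : ℝ) :
    0 ≤ deriv (fun t => softPos δ (t - k)) t := by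
  rw [softPos_sub_deriv hδ]
  exact div_nonneg (softPos_pos hδ _).le (sqrt_sq_add_sq_pos hδ _).le

theorem softPos_sub_deriv_le_one {δ : ℝ} (hδ : 0 < δ) (k t : ℝ) :
    deriv (fun t => softPos δ (t - k)) t ≤ 1 := by
  rw [softPos_sub_deriv hδ]
  exact div_le_one_of_le₀ (softPos_le_sqrt hδ _) (sqrt_sq_add_sq_pos hδ _).le

theorem contDiff_softPos_sub {δ : ℝ} (hδ : 0 < δ) (k : ℝ) :
    ContDiff ℝ (⊤ : ℕ∞) (fun t => softPos δ (t - k)) :=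
  (contDiff_softPos hδ).comp (contDiff_id.sub contDiff_const)

theorem isWeakPartial_weakPartial {Ω : TopologicalSpace.Opens (Space d)} {u : Space d → ℝ}
    (hu : MemW1 Ω 2 u) (i : Fin d) :
    IsWeakPartial Ω i u (weakPartial Ω i u) ∧ MemLp (weakPartial Ω i u) 2 (vol Ω) := by
  obtain ⟨g, hg, hgL⟩ := hu.2 i
  have hex : ∃ g, IsWeakPartial Ω i u g := ⟨g, hg⟩
  refine ⟨?_, hgL.ae_eq hg.ae_eq_weakPartial.symm⟩
  rw [weakPartial, dif_pos hex]
  exact hex.choose_spec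

/-- For a test function `ζ` and `β` the smooth positive part of `u - k`, the product `ζ β(u)` is an
`L²` limit of test functions, with the expected limits of the partial derivatives. -/
theorem exists_testFunction_tendsto_softPos {Ω : TopologicalSpace.Opens (Space d)}
    {u : Space d → ℝ} (hu : MemW1 Ω 2 u) (ζ : 𝓓(Ω, ℝ)) {k δ : ℝ} (hδ : 0 < δ) {β : ℝ → ℝ}
    (hβ : β = fun t => softPos δ (t - k)) :
    ∃ φ : ℕ → 𝓓(Ω, ℝ), AEStronglyMeasurable (fun x => ζ x * β (u x)) (vol Ω) ∧
      (∀ i, AEStronglyMeasurable (fun x => ζ x * deriv β (u x) * weakPartial Ω i u x +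
        partialDeriv i ζ x * β (u x)) (vol Ω)) ∧
      Tendsto (fun n => eLpNorm (fun x => φ n x - ζ x * β (u x)) 2 (vol Ω)) atTop (𝓝 0) ∧
      ∀ i, Tendsto (fun n => eLpNorm (fun x => partialDeriv i (φ n) x -
        (ζ x * deriv β (u x) * weakPartial Ω i u x + partialDeriv i ζ x * β (u x))) 2 (vol Ω))
        atTop (𝓝 0) := by
  have hβc : ContDiff ℝ (⊤ : ℕ∞) β := hβ ▸ contDiff_softPos_sub hδ k
  have hβ1 : ∀ t, |deriv β t| ≤ 1 := fun t => by
    rw [hβ, abs_of_nonneg (softPos_sub_deriv_nonneg hδ k t)]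
    exact softPos_sub_deriv_le_one hδ k t
  obtain ⟨φ, h1, h2⟩ := exists_testFunction_tendsto hu.1
    (fun i => (isWeakPartial_weakPartial hu i).2) (fun i => (isWeakPartial_weakPartial hu i).1)
    ζ hβc hβ1
  have hm := hβc.continuous.comp_aestronglyMeasurable hu.1.1
  exact ⟨φ, ζ.continuous.aestronglyMeasurable.mul hm, fun i =>
    ((ζ.continuous.aestronglyMeasurable.mul
      ((hβc.continuous_deriv (by simp)).comp_aestronglyMeasurable hu.1.1)).mul
      (isWeakPartial_weakPartial hu i).2.1).add
      ((continuous_partialDeriv i ζ).aestronglyMeasurable.mul hm), h1, h2⟩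

theorem integrable_sum_partialDeriv_sq_mul {Ω : TopologicalSpace.Opens (Space d)}
    (η : 𝓓(Ω, ℝ)) {f : Space d → ℝ} (hf : MemLp f 2 (vol Ω)) :
    Integrable (fun x => (∑ i, partialDeriv i η x ^ 2) * f x ^ 2) (vol Ω) := by
  have e : (fun x => (∑ i, partialDeriv i η x ^ 2) * f x ^ 2) =
      fun x => ∑ i, (partialDeriv i η x * f x) ^ 2 := by
    ext x
    rw [Finset.sum_mul]
    simp only [mul_pow]
  rw [e]
  refine integrable_finsetSum _ fun i _ => ?_
  obtain ⟨M, hM⟩ := (continuous_partialDeriv i η).bounded_above_of_compact_support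
    (hasCompactSupport_partialDeriv i η)
  exact (memLp_bounded_mul (continuous_partialDeriv i η).aestronglyMeasurable hM hf).integrable_sq

theorem integrable_sum_partialDeriv_sq {Ω : TopologicalSpace.Opens (Space d)} (η : 𝓓(Ω, ℝ)) :
    Integrable (fun x => ∑ i, partialDeriv i η x ^ 2) (vol Ω) :=
  integrable_finsetSum _ fun i _ => (memLp_partialDeriv i η).integrable_sq

/-- The Caccioppoli inequality for `η β(u - k)`, where `β` is the smooth positive part: the
subsolution is tested with `η² β(u - k)`. -/
theorem caccioppoli {Ω : TopologicalSpace.Opens (Space d)}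
    {a : Space d → Matrix (Fin d) (Fin d) ℝ} {lam Lam : ℝ} (ha : IsElliptic Ω a lam Lam)
    {u : Space d → ℝ} (hu : IsWeakSubsolution Ω a u) (η : 𝓓(Ω, ℝ)) {k δ : ℝ} (hk : 0 ≤ k)
    (hδ : 0 < δ) {β : ℝ → ℝ} (hβ : β = fun t => softPos δ (t - k)) :
    ∫ x, ∑ i, (η x * deriv β (u x) * weakPartial Ω i u x + partialDeriv i η x * β (u x)) ^ 2
        ∂(vol Ω) ≤
      10 * (Lam / lam) * ∫ x, (∑ i, partialDeriv i η x ^ 2) * (max (u x - k) 0 ^ 2 + δ ^ 2)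
        ∂(vol Ω) := by
  have hβ0 : ∀ t, β t = softPos δ (t - k) := fun t => by rw [hβ]
  -- the test function
  obtain ⟨η2, hη2⟩ : ∃ η2 : 𝓓(Ω, ℝ), ⇑η2 = fun x => η x ^ 2 := by
    have h1 : tsupport (fun x => η x ^ 2) ⊆ tsupport η :=
      closure_mono fun x hx h0 => hx (by simp only [h0]; norm_num)
    exact ⟨⟨fun x => η x ^ 2, η.contDiff.pow 2,
      η.hasCompactSupport.of_isClosed_subset (isClosed_tsupport _) h1,
      h1.trans η.tsupport_subset⟩, rfl⟩
  obtain ⟨φ, hFm, hGm, hφ, hφd⟩ := exists_testFunction_tendsto_softPos hu.1 η2 (k := k) hδ hβ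
  obtain ⟨hW, hwF⟩ := memW120_of_tendsto hFm hGm hφ hφd
  have hGL := fun i => memLp_of_tendsto (fun n => memLp_partialDeriv i (φ n)) (hGm i) (hφd i)
  set F : Space d → ℝ := fun x => η2 x * β (u x) with hF
  have hbil : bilin Ω a u F ≤ 0 := by
    refine hu.2 F hW (Eventually.of_forall fun x => ?_)
    simp only [hF, hη2, hβ0]
    exact mul_nonneg (sq_nonneg _) (softPos_pos hδ _).le
  -- integrability of the three terms of the pointwise inequality `hpt` below; the first is a
  -- squared `L²` limit of gradients of test functions, with cutoff `η` in place of `η²`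
  obtain ⟨φ', -, hGm', -, hφd'⟩ := exists_testFunction_tendsto_softPos hu.1 η (k := k) hδ hβ
  have hGL' := fun i => memLp_of_tendsto (fun n => memLp_partialDeriv i (φ' n)) (hGm' i) (hφd' i)
  have I1 : Integrable (fun x => ∑ i, (η x * deriv β (u x) * weakPartial Ω i u x +
      partialDeriv i η x * β (u x)) ^ 2) (vol Ω) :=
    integrable_finsetSum _ fun i _ => (hGL' i).integrable_sq
  have I2 : Integrable (fun x => inner ℝ (weakGrad Ω F x)
      (Matrix.toEuclideanLin (a x) (weakGrad Ω u x))) (vol Ω) := by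
    have e : (fun x => inner ℝ (weakGrad Ω F x)
        (Matrix.toEuclideanLin (a x) (weakGrad Ω u x))) = fun x => ∑ i, weakPartial Ω i F x *
          Matrix.toEuclideanLin (a x) (weakGrad Ω u x) i := by
      ext x
      rw [PiLp.inner_apply]
      exact Finset.sum_congr rfl fun i _ => mul_comm _ _
    rw [e]
    exact integrable_finsetSum _ fun i _ =>
      ((hGL i).ae_eq (hwF i).ae_eq_weakPartial.symm).integrable_mul
        (memLp_flux ha (fun j => (isWeakPartial_weakPartial hu.1 j).2) i)
  have I3 : Integrable (fun x => (∑ i, partialDeriv i η x ^ 2) *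
      (max (u x - k) 0 ^ 2 + δ ^ 2)) (vol Ω) := by
    simp only [mul_add]
    exact (integrable_sum_partialDeriv_sq_mul η (memLp_max_sub hu.1.1 hk)).add
      ((integrable_sum_partialDeriv_sq η).mul_const _)
  have hae : ∀ᵐ x ∂(vol Ω), ∀ i, weakPartial Ω i F x = η2 x * deriv β (u x) *
      weakPartial Ω i u x + partialDeriv i η2 x * β (u x) :=
    ae_all_iff.2 fun i => (hwF i).ae_eq_weakPartial
  have hpt : ∀ᵐ x ∂(vol Ω), ∑ i, (η x * deriv β (u x) * weakPartial Ω i u x +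
      partialDeriv i η x * β (u x)) ^ 2 ≤
      4 / lam * inner ℝ (weakGrad Ω F x) (Matrix.toEuclideanLin (a x) (weakGrad Ω u x)) +
        10 * (Lam / lam) * ((∑ i, partialDeriv i η x ^ 2) * (max (u x - k) 0 ^ 2 + δ ^ 2)) := by
    filter_upwards [ha.coercive, hae] with x hx hFx
    obtain ⟨q, hq⟩ : ∃ q : Space d, q = WithLp.toLp 2 fun i => partialDeriv i η x := ⟨_, rfl⟩
    have hr := sqrt_sq_add_sq_pos hδ (u x - k)
    have h1 := norm_sq_le_of_elliptic ha.lam_pos ha.lam_le hx (weakGrad Ω u x) q (s := η x)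
      (softPos_sub_deriv_nonneg hδ k (u x)) (softPos_sub_deriv_le_one hδ k (u x)) hr
      (v := β (u x)) (by rw [softPos_sub_deriv hδ, hβ0, div_mul_cancel₀ _ hr.ne'])
    rw [← hβ] at h1
    have e1 : (η x ^ 2 * deriv β (u x)) • weakGrad Ω u x + (2 * η x * β (u x)) • q =
        weakGrad Ω F x := by
      ext i
      have := partialDeriv_sq η i x
      simp only [weakGrad, hFx, hq, hη2, this, PiLp.add_apply, PiLp.smul_apply, smul_eq_mul]
      ring
    have e2 : ‖(η x * deriv β (u x)) • weakGrad Ω u x + β (u x) • q‖ ^ 2 =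
        ∑ i, (η x * deriv β (u x) * weakPartial Ω i u x + partialDeriv i η x * β (u x)) ^ 2 := by
      rw [EuclideanSpace.real_norm_sq_eq]
      refine Finset.sum_congr rfl fun i _ => ?_
      simp only [weakGrad, hq, PiLp.add_apply, PiLp.smul_apply, smul_eq_mul]
      ring
    have e3 : ‖q‖ ^ 2 = ∑ i, partialDeriv i η x ^ 2 := by
      rw [EuclideanSpace.real_norm_sq_eq, hq]
    rw [e1, e2, e3, hβ0] at h1
    rw [← hβ0] at h1
    refine h1.trans ?_
    have h2 := softPos_mul_sqrt_le hδ (u x - k)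
    rw [← hβ0] at h2
    have hL : 0 ≤ Lam / lam := div_nonneg (ha.lam_pos.le.trans ha.lam_le) ha.lam_pos.le
    gcongr
  calc _ ≤ ∫ x, (4 / lam * inner ℝ (weakGrad Ω F x)
        (Matrix.toEuclideanLin (a x) (weakGrad Ω u x)) +
        10 * (Lam / lam) * ((∑ i, partialDeriv i η x ^ 2) * (max (u x - k) 0 ^ 2 + δ ^ 2)))
        ∂(vol Ω) := integral_mono_ae I1 ((I2.const_mul _).add (I3.const_mul _)) hpt
    _ = 4 / lam * bilin Ω a u F + 10 * (Lam / lam) * ∫ x, (∑ i, partialDeriv i η x ^ 2) *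
        (max (u x - k) 0 ^ 2 + δ ^ 2) ∂(vol Ω) := by
        rw [integral_add (I2.const_mul _) (I3.const_mul _), integral_const_mul,
          integral_const_mul, bilin]
    _ ≤ _ := by
        have : 4 / lam * bilin Ω a u F ≤ 0 :=
          mul_nonpos_of_nonneg_of_nonpos (div_nonneg (by norm_num) ha.lam_pos.le) hbil
        linarith

/-- The Caccioppoli and Sobolev inequalities combined, for the truncation `(u - k)₊`; the smooth
positive part is removed by letting `δ` tend to `0`. -/
theorem exists_caccioppoli_sobolev (hd : 3 ≤ d) : ∃ S : ℝ, 0 < S ∧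
    ∀ (Ω : TopologicalSpace.Opens (Space d)) (a : Space d → Matrix (Fin d) (Fin d) ℝ)
      (lam Lam : ℝ), IsElliptic Ω a lam Lam → ∀ u, IsWeakSubsolution Ω a u →
      ∀ (η : 𝓓(Ω, ℝ)) (k : ℝ), 0 ≤ k → ∀ E ⊆ (Ω : Set (Space d)), volume E ≠ ∞ →
        ∫ x in E, (η x * max (u x - k) 0) ^ 2 ≤
          S * (Lam / lam) * volume.real E ^ (2 / (d : ℝ)) *
            ∫ x, (∑ i, partialDeriv i η x ^ 2) * max (u x - k) 0 ^ 2 ∂(vol Ω) := by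
  obtain ⟨S, hS, hSob⟩ := exists_sobolev_const hd
  refine ⟨10 * S, by positivity, fun Ω a lam Lam ha u hu η k hk E hE hEfin => ?_⟩
  have hL : 0 ≤ Lam / lam := div_nonneg (ha.lam_pos.le.trans ha.lam_le) ha.lam_pos.le
  set V := volume.real E ^ (2 / (d : ℝ))
  have hV : 0 ≤ V := Real.rpow_nonneg measureReal_nonneg _
  set I := ∫ x, (∑ i, partialDeriv i η x ^ 2) * max (u x - k) 0 ^ 2 ∂(vol Ω)
  set J := ∫ x, ∑ i, partialDeriv i η x ^ 2 ∂(vol Ω)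
  have key : ∀ δ : ℝ, 0 < δ → ∫ x in E, (η x * max (u x - k) 0) ^ 2 ≤
      S * V * (10 * (Lam / lam) * (I + J * δ ^ 2)) := by
    intro δ hδ
    obtain ⟨β, hβ⟩ : ∃ β, β = fun t => softPos δ (t - k) := ⟨_, rfl⟩
    obtain ⟨φ, hFm, hGm, hφ, hφd⟩ := exists_testFunction_tendsto_softPos hu.1 η (k := k) hδ hβ
    have h1 := hSob Ω φ _ _ hFm hGm hφ hφd E hE hEfin
    have h2 := caccioppoli ha hu η hk hδ hβ
    have h3 : ∫ x, (∑ i, partialDeriv i η x ^ 2) * (max (u x - k) 0 ^ 2 + δ ^ 2) ∂(vol Ω) =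
        I + J * δ ^ 2 := by
      simp only [mul_add]
      rw [integral_add (integrable_sum_partialDeriv_sq_mul η (memLp_max_sub hu.1.1 hk))
        ((integrable_sum_partialDeriv_sq η).mul_const _), integral_mul_const]
    rw [h3] at h2
    have hFL : MemLp (fun x => η x * β (u x)) 2 (volume.restrict E) :=
      (memLp_of_tendsto (fun n => memLp_testFunction (φ n)) hFm hφ).mono_measure
        (Measure.restrict_mono hE le_rfl)
    refine le_trans (integral_mono_of_nonneg (Eventually.of_forall fun x => sq_nonneg _)
      hFL.integrable_sq (Eventually.of_forall fun x => ?_))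
      (h1.trans (mul_le_mul_of_nonneg_left h2 (by positivity)))
    have h4 := max_le_softPos hδ (u x - k)
    have h5 : (0 : ℝ) ≤ max (u x - k) 0 := le_max_right _ _
    simp only [mul_pow, hβ]
    gcongr
  have hlim : Tendsto (fun δ : ℝ => S * V * (10 * (Lam / lam) * (I + J * δ ^ 2))) (𝓝[>] 0)
      (𝓝 (S * V * (10 * (Lam / lam) * (I + J * 0 ^ 2)))) := by
    have : Continuous fun δ : ℝ => S * V * (10 * (Lam / lam) * (I + J * δ ^ 2)) := by fun_prop
    exact (this.tendsto 0).mono_left nhdsWithin_le_nhds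
  refine (ge_of_tendsto hlim (eventually_mem_nhdsWithin.mono key)).trans (le_of_eq ?_)
  ring

/-! ### Cutoff functions and the iteration step -/

theorem exists_deriv_smoothTransition_bound : ∃ M : ℝ, ∀ t, |deriv Real.smoothTransition t| ≤ M := by
  have hc : Continuous (deriv Real.smoothTransition) :=
    (Real.smoothTransition.contDiff (n := 1)).continuous_deriv le_rfl
  refine hc.bounded_above_of_compact_support
    (HasCompactSupport.intro (isCompact_Icc (a := (0 : ℝ)) (b := 1)) fun t ht => ?_)
  rw [Set.mem_Icc, not_and_or, not_le, not_le] at ht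
  rcases ht with ht | ht
  · have : Real.smoothTransition =ᶠ[𝓝 t] fun _ => 0 := by
      filter_upwards [Iio_mem_nhds ht] with s hs
      exact Real.smoothTransition.zero_of_nonpos (le_of_lt hs)
    rw [this.deriv_eq, deriv_const]
  · have : Real.smoothTransition =ᶠ[𝓝 t] fun _ => 1 := by
      filter_upwards [Ioi_mem_nhds ht] with s hs
      exact Real.smoothTransition.one_of_one_le (le_of_lt hs)
    rw [this.deriv_eq, deriv_const]

/-- Cutoff functions between concentric balls, with the expected bound on the gradient. -/
theorem exists_cutoff (d : ℕ) : ∃ M : ℝ, 0 < M ∧ ∀ r R : ℝ, 0 < r → r < R → R < 1 →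
    ∃ η : 𝓓(ballO d 1, ℝ), (∀ x ∈ Metric.closedBall (0 : Space d) r, η x = 1) ∧
      (∀ x, ∑ i, partialDeriv i η x ^ 2 ≤ M / (R - r) ^ 2) ∧
      ∀ x ∉ Metric.closedBall (0 : Space d) R, η x = 0 ∧ ∑ i, partialDeriv i η x ^ 2 = 0 := by
  obtain ⟨M, hM⟩ := exists_deriv_smoothTransition_bound
  refine ⟨4 * M ^ 2 + 1, by positivity, fun r R hr hrR hR => ?_⟩
  have hD : 0 < R ^ 2 - r ^ 2 := by nlinarith
  -- the squared norm keeps the cutoff smooth at the origin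
  obtain ⟨f, hf⟩ : ∃ f : Space d → ℝ,
      f = fun x => Real.smoothTransition ((R ^ 2 - ‖x‖ ^ 2) / (R ^ 2 - r ^ 2)) := ⟨_, rfl⟩
  have hfd : ContDiff ℝ (⊤ : ℕ∞) f := by
    rw [hf]
    exact Real.smoothTransition.contDiff.comp
      ((contDiff_const.sub (contDiff_norm_sq ℝ)).div_const _)
  have hf0 : ∀ x ∉ Metric.closedBall (0 : Space d) R, f x = 0 := by
    intro x hx
    rw [mem_closedBall_zero_iff, not_le] at hx
    rw [hf]
    refine Real.smoothTransition.zero_of_nonpos (div_nonpos_of_nonpos_of_nonneg ?_ hD.le)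
    nlinarith
  have hts : tsupport f ⊆ Metric.closedBall (0 : Space d) R :=
    closure_minimal (fun x hx => by_contra fun h => hx (hf0 x h)) Metric.isClosed_closedBall
  obtain ⟨η, hη⟩ : ∃ η : 𝓓(ballO d 1, ℝ), ⇑η = f :=
    ⟨⟨f, hfd, (isCompact_closedBall _ _).of_isClosed_subset (isClosed_tsupport _) hts,
      hts.trans (Metric.closedBall_subset_ball hR)⟩, rfl⟩
  have hd0 : ∀ x ∉ Metric.closedBall (0 : Space d) R, ∑ i, partialDeriv i η x ^ 2 = 0 := by
    intro x hx
    have h1 : x ∉ tsupport (fderiv ℝ f) := fun h => hx (hts (tsupport_fderiv_subset ℝ h))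
    refine Finset.sum_eq_zero fun i _ => ?_
    rw [partialDeriv, hη, image_eq_zero_of_notMem_tsupport h1, zero_apply]
    norm_num
  refine ⟨η, fun x hx => ?_, fun x => ?_, fun x hx => ⟨by rw [hη, hf0 x hx], hd0 x hx⟩⟩
  · rw [mem_closedBall_zero_iff] at hx
    rw [hη, hf]
    refine Real.smoothTransition.one_of_one_le ?_
    rw [le_div_iff₀ hD]
    nlinarith [norm_nonneg x]
  · by_cases hx : x ∈ Metric.closedBall (0 : Space d) R
    · rw [mem_closedBall_zero_iff] at hx
      set t := (R ^ 2 - ‖x‖ ^ 2) / (R ^ 2 - r ^ 2) with ht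
      have h1 : ∀ i, partialDeriv i η x =
          deriv Real.smoothTransition t * (-(2 * x i) / (R ^ 2 - r ^ 2)) := by
        intro i
        have h2 : HasFDerivAt (fun x : Space d => (R ^ 2 - ‖x‖ ^ 2) / (R ^ 2 - r ^ 2))
            ((R ^ 2 - r ^ 2)⁻¹ • -(2 • innerSL ℝ x) : Space d →L[ℝ] ℝ) x := by
          have := ((hasStrictFDerivAt_norm_sq x).hasFDerivAt.const_sub (R ^ 2)).mul_const
            (R ^ 2 - r ^ 2)⁻¹
          simpa only [div_eq_mul_inv] using this
        have h3 := ((Real.smoothTransition.contDiff (n := 1)).differentiable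
          one_ne_zero t).hasDerivAt.comp_hasFDerivAt x h2
        rw [partialDeriv, hη, show f = Real.smoothTransition ∘
          fun x => (R ^ 2 - ‖x‖ ^ 2) / (R ^ 2 - r ^ 2) from hf, h3.fderiv]
        simp [EuclideanSpace.inner_single_right]
        ring
      have h2 : ∑ i, partialDeriv i η x ^ 2 =
          deriv Real.smoothTransition t ^ 2 * (4 * ‖x‖ ^ 2 / (R ^ 2 - r ^ 2) ^ 2) := by
        rw [EuclideanSpace.real_norm_sq_eq, Finset.mul_sum, Finset.sum_div, Finset.mul_sum]
        refine Finset.sum_congr rfl fun i _ => ?_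
        rw [h1]
        generalize R ^ 2 - r ^ 2 = c
        ring
      have h3 : deriv Real.smoothTransition t ^ 2 ≤ M ^ 2 := by
        rw [← sq_abs]
        exact pow_le_pow_left₀ (abs_nonneg _) (hM t) 2
      have h4 : 4 * ‖x‖ ^ 2 / (R ^ 2 - r ^ 2) ^ 2 ≤ 4 / (R - r) ^ 2 := by
        have h5 : 0 < R - r := by linarith
        have h6 : ‖x‖ ^ 2 ≤ (R + r) ^ 2 :=
          pow_le_pow_left₀ (norm_nonneg x) (by linarith) 2
        have e : R ^ 2 - r ^ 2 = (R - r) * (R + r) := by ring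
        rw [e, div_le_div_iff₀ (by have : 0 < R + r := by linarith
                                   positivity) (by positivity), mul_pow]
        nlinarith [mul_le_mul_of_nonneg_left h6 (sq_nonneg (R - r))]
      rw [h2]
      calc _ ≤ M ^ 2 * (4 / (R - r) ^ 2) := by gcongr
        _ ≤ _ := by
          rw [← mul_div_assoc]
          gcongr
          linarith
    · rw [hd0 x hx]
      positivity

/-- One step of De Giorgi's iteration: passing to a smaller ball and a higher level improves the
power of the truncated energy. -/
theorem exists_deGiorgi_step (hd : 3 ≤ d) : ∃ C : ℝ, 0 < C ∧
    ∀ (a : Space d → Matrix (Fin d) (Fin d) ℝ) (lam Lam : ℝ), IsElliptic (ballO d 1) a lam Lam →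
      ∀ u, IsWeakSubsolution (ballO d 1) a u →
      ∀ r R k h : ℝ, 0 < r → r < R → R < 1 → 0 ≤ k → k < h →
        ∫ x in Metric.closedBall 0 r, max (u x - h) 0 ^ 2 ≤
          C * (Lam / lam) / (R - r) ^ 2 *
            ((∫ x in Metric.closedBall 0 R, max (u x - k) 0 ^ 2) / (h - k) ^ 2) ^ (2 / (d : ℝ)) *
            ∫ x in Metric.closedBall 0 R, max (u x - k) 0 ^ 2 := by
  obtain ⟨S, hS, hCS⟩ := exists_caccioppoli_sobolev hd
  obtain ⟨M, hM, hcut⟩ := exists_cutoff d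
  refine ⟨S * M, by positivity, fun a lam Lam ha u hu r R k h hr hrR hR hk hkh => ?_⟩
  obtain ⟨η, hη1, hηd, hη0⟩ := hcut r R hr hrR hR
  have hL : 0 ≤ Lam / lam := div_nonneg (ha.lam_pos.le.trans ha.lam_le) ha.lam_pos.le
  obtain ⟨B, hB⟩ : ∃ B, B = Metric.closedBall (0 : Space d) R := ⟨_, rfl⟩
  have hBm : MeasurableSet B := hB ▸ Metric.isClosed_closedBall.measurableSet
  have hBΩ : B ⊆ (ballO d 1 : Set (Space d)) := hB ▸ Metric.closedBall_subset_ball hR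
  have hBle : volume.restrict B ≤ vol (ballO d 1) := Measure.restrict_mono hBΩ le_rfl
  have hBfin : volume B ≠ ∞ := hB ▸ (isCompact_closedBall _ _).measure_lt_top.ne
  have hrB : Metric.closedBall (0 : Space d) r ⊆ B :=
    hB ▸ Metric.closedBall_subset_closedBall hrR.le
  rw [← hB] at hη0 ⊢
  have huk : IntegrableOn (fun x => max (u x - k) 0 ^ 2) B :=
    ((memLp_max_sub hu.1.1 hk).mono_measure hBle).integrable_sq
  have hmono : ∀ x, max (u x - h) 0 ^ 2 ≤ max (u x - k) 0 ^ 2 := fun x =>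
    pow_le_pow_left₀ (le_max_right _ _) (max_le_max_right _ (by linarith)) 2
  -- the superlevel set, made measurable through a measurable representative of `u`
  have hum : AEStronglyMeasurable u (volume.restrict B) := hu.1.1.1.mono_measure hBle
  obtain ⟨E, hE⟩ : ∃ E, E = B ∩ {x | h < hum.mk u x} := ⟨_, rfl⟩
  have hEm : MeasurableSet E := hE ▸ hBm.inter
    (measurableSet_lt measurable_const hum.stronglyMeasurable_mk.measurable)
  have hEB : E ⊆ B := hE ▸ Set.inter_subset_left
  have hEfin : volume E ≠ ∞ := measure_ne_top_of_subset hEB hBfin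
  have huE : ∀ᵐ x ∂(volume.restrict B), x ∈ E ↔ h < u x := by
    filter_upwards [hum.ae_eq_mk, ae_restrict_mem hBm] with x hx hxB
    rw [hE, hx]
    exact ⟨fun h' => h'.2, fun h' => ⟨hxB, h'⟩⟩
  set A := ∫ x in B, max (u x - k) 0 ^ 2
  have hA0 : 0 ≤ A := integral_nonneg fun x => sq_nonneg _
  have hcheb : volume.real E ≤ A / (h - k) ^ 2 := by
    have hpos : 0 < h - k := by linarith
    rw [le_div_iff₀ (by positivity)]
    calc volume.real E * (h - k) ^ 2 = ∫ _ in E, (h - k) ^ 2 := by simp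
      _ ≤ ∫ x in E, max (u x - k) 0 ^ 2 := by
          refine integral_mono_ae (integrableOn_const hEfin) (huk.mono_set hEB) ?_
          filter_upwards [ae_restrict_of_ae_restrict_of_subset hEB huE, ae_restrict_mem hEm]
            with x hx hxE
          have h1 : h - k ≤ max (u x - k) 0 := le_max_of_le_left (by linarith [hx.1 hxE])
          exact pow_le_pow_left₀ hpos.le h1 2
      _ ≤ A := setIntegral_mono_set huk (Eventually.of_forall fun x => sq_nonneg _)
          (Eventually.of_forall hEB)
  have hleft : ∫ x in Metric.closedBall 0 r, max (u x - h) 0 ^ 2 ≤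
      ∫ x in E, (η x * max (u x - h) 0) ^ 2 := by
    have hηint : IntegrableOn (fun x => (η x * max (u x - h) 0) ^ 2) B := by
      obtain ⟨N, hN⟩ := η.continuous.bounded_above_of_compact_support η.hasCompactSupport
      exact (memLp_bounded_mul η.continuous.aestronglyMeasurable hN
        ((memLp_max_sub hu.1.1 (hk.trans hkh.le)).mono_measure hBle)).integrable_sq
    calc _ = ∫ x in Metric.closedBall 0 r, (η x * max (u x - h) 0) ^ 2 := by
          refine setIntegral_congr_fun Metric.isClosed_closedBall.measurableSet fun x hx => ?_
          simp only [hη1 x hx, one_mul]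
      _ ≤ ∫ x in B, (η x * max (u x - h) 0) ^ 2 :=
          setIntegral_mono_set hηint (Eventually.of_forall fun x => sq_nonneg _)
            (Eventually.of_forall hrB)
      _ = ∫ x in B, E.indicator (fun x => (η x * max (u x - h) 0) ^ 2) x := by
          refine integral_congr_ae ?_
          filter_upwards [huE] with x hx
          by_cases hxE : x ∈ E
          · rw [Set.indicator_of_mem hxE]
          · have h1 : max (u x - h) 0 = 0 :=
              max_eq_right (by linarith [not_lt.1 (fun h' => hxE (hx.2 h'))])
            simp [Set.indicator_of_notMem hxE, h1]
      _ = _ := by rw [setIntegral_indicator hEm, Set.inter_eq_right.2 hEB]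
  have hright : ∫ x, (∑ i, partialDeriv i η x ^ 2) * max (u x - h) 0 ^ 2 ∂(vol (ballO d 1)) ≤
      M / (R - r) ^ 2 * A := by
    calc _ ≤ ∫ x, B.indicator (fun x => M / (R - r) ^ 2 * max (u x - k) 0 ^ 2) x
          ∂(vol (ballO d 1)) := by
          refine integral_mono_of_nonneg (Eventually.of_forall fun x => by positivity) ?_
            (Eventually.of_forall fun x => ?_)
          · rw [integrable_indicator_iff hBm, IntegrableOn, vol_restrict_of_subset hBm hBΩ]
            exact huk.const_mul _
          · by_cases hx : x ∈ B
            · simp only [Set.indicator_of_mem hx]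
              exact mul_le_mul (hηd x) (hmono x) (sq_nonneg _) (by positivity)
            · simp only [Set.indicator_of_notMem hx, (hη0 x hx).2, zero_mul, le_refl]
      _ = _ := by
          rw [integral_indicator hBm, vol_restrict_of_subset hBm hBΩ, integral_const_mul]
  calc _ ≤ _ := hleft
    _ ≤ _ := hCS _ a lam Lam ha u hu η h (hk.trans hkh.le) E (hEB.trans hBΩ) hEfin
    _ ≤ S * (Lam / lam) * (A / (h - k) ^ 2) ^ (2 / (d : ℝ)) * (M / (R - r) ^ 2 * A) := by
        gcongr
    _ = _ := by ring

/-- Fast geometric convergence for the recursive inequality of De Giorgi's iteration. -/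
theorem le_geometric_of_deGiorgi_recursion (hd : 0 < d) {A : ℕ → ℝ} {C L D T K θ : ℝ}
    (hA : ∀ j, 0 ≤ A j) (hT : 0 < T) (hC : 0 < C) (hDL : 1 ≤ D * L) (hL : 1 ≤ L)
    (hθ : θ = (1 / 4) * (1 / 2) ^ d) (hD : 64 * C ≤ θ * D) (hK : K ^ 2 = 4 * T * (D * L) ^ (2 * d))
    (h0 : A 0 ≤ T)
    (hstep : ∀ j, A (j + 1) ≤
      C * L * (64 * 4 ^ j) * (A j * 4 ^ (j + 1) / K ^ 2) ^ (2 / (d : ℝ)) * A j) (j : ℕ) :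
    A j ≤ T * θ ^ j := by
  have hd0 : (d : ℝ) ≠ 0 := by exact_mod_cast hd.ne'
  have hDL0 : 0 < D * L := by linarith
  have hθ0 : 0 < θ := by rw [hθ]; positivity
  induction j with
  | zero => simpa using h0
  | succ j ih =>
    -- the choice of `θ` and `K` makes the base of the power a perfect `d`-th power
    have hX : T * θ ^ j * 4 ^ (j + 1) / K ^ 2 = (((D * L)⁻¹) ^ 2 * (1 / 2) ^ j) ^ d := by
      have e1 : ((1 / 4 : ℝ) * (1 / 2) ^ d) ^ j = ((1 / 2) ^ j) ^ d / 4 ^ j := by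
        rw [mul_pow, ← pow_mul, ← pow_mul, mul_comm d j, one_div_pow 4]
        ring
      have e2 : (((D * L)⁻¹) ^ 2) ^ d = ((D * L) ^ (2 * d))⁻¹ := by rw [← pow_mul, inv_pow]
      rw [hK, hθ, e1, mul_pow _ _ d, e2, pow_succ]
      generalize (D * L) ^ (2 * d) = P
      field_simp
    have hXp : (T * θ ^ j * 4 ^ (j + 1) / K ^ 2) ^ (2 / (d : ℝ)) =
        ((D * L)⁻¹) ^ 4 * (1 / 4) ^ j := by
      have h4 : (1 / 4 : ℝ) = (1 / 2) ^ 2 := by norm_num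
      rw [hX, ← Real.rpow_natCast _ d, ← Real.rpow_mul (by positivity), mul_div_cancel₀ _ hd0,
        Real.rpow_two, h4, mul_pow, ← pow_mul, ← pow_mul, ← pow_mul, mul_comm j 2]
    have hK0 : 0 < K ^ 2 := by rw [hK]; positivity
    calc A (j + 1) ≤ _ := hstep j
      _ ≤ C * L * (64 * 4 ^ j) * (T * θ ^ j * 4 ^ (j + 1) / K ^ 2) ^ (2 / (d : ℝ)) *
          (T * θ ^ j) := by
          have := hA j
          gcongr
      _ = 64 * C * L * ((D * L)⁻¹) ^ 4 * (T * θ ^ j) := by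
          rw [hXp, one_div_pow]
          field_simp
      _ ≤ θ * (T * θ ^ j) := by
          refine mul_le_mul_of_nonneg_right ?_ (by positivity)
          rw [inv_pow, mul_inv_le_iff₀ (by positivity)]
          calc 64 * C * L ≤ θ * D * L := by gcongr
            _ = θ * (D * L) ^ 1 := by ring
            _ ≤ θ * (D * L) ^ 4 := by
                gcongr
                norm_num
      _ = _ := by ring

/-! ### The local maximum principle -/

/-- The local maximum principle, with the level in terms of any positive bound `T` for the energy
of the positive part. -/
theorem exists_le_of_integral_le (hd : 3 ≤ d) : ∃ D : ℝ, 0 < D ∧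
    ∀ (a : Space d → Matrix (Fin d) (Fin d) ℝ) (lam Lam : ℝ), IsElliptic (ballO d 1) a lam Lam →
      ∀ u, IsWeakSubsolution (ballO d 1) a u → ∀ T : ℝ, 0 < T →
      ∫ x, max (u x) 0 ^ 2 ∂(vol (ballO d 1)) ≤ T →
      ∀ᵐ x ∂(vol (ballO d (1 / 2))), u x ≤ 2 * √T * (D * (Lam / lam)) ^ d := by
  obtain ⟨C, hC, hstep⟩ := exists_deGiorgi_step hd
  obtain ⟨θ, hθ⟩ : ∃ θ : ℝ, θ = (1 / 4) * (1 / 2) ^ d := ⟨_, rfl⟩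
  have hθ0 : 0 < θ := by rw [hθ]; positivity
  have hθ1 : θ < 1 := by
    rw [hθ]
    have : (1 / 2 : ℝ) ^ d ≤ 1 := pow_le_one₀ (by norm_num) (by norm_num)
    linarith
  -- `64` comes from the steps `r j - r (j + 1) = 2 ^ (-j) / 8` of the radii
  obtain ⟨D, hDdef⟩ : ∃ D : ℝ, D = 1 + 64 * C / θ := ⟨_, rfl⟩
  have hD1 : 1 ≤ D := by
    rw [hDdef]
    linarith [show 0 ≤ 64 * C / θ by positivity]
  refine ⟨D, by linarith, fun a lam Lam ha u hu T hT huT => ?_⟩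
  have hlam := ha.lam_pos
  have hL : 1 ≤ Lam / lam := (one_le_div hlam).2 ha.lam_le
  obtain ⟨L, hLdef⟩ : ∃ L, L = Lam / lam := ⟨_, rfl⟩
  rw [← hLdef] at hL ⊢
  obtain ⟨K, hK⟩ : ∃ K, K = 2 * √T * (D * L) ^ d := ⟨_, rfl⟩
  have hDL : 1 ≤ D * L := one_le_mul_of_one_le_of_one_le hD1 hL
  have hK0 : 0 < K := by
    rw [hK]
    have := Real.sqrt_pos.2 hT
    positivity
  have hK2 : K ^ 2 = 4 * T * (D * L) ^ (2 * d) := by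
    rw [hK, mul_pow, mul_pow, Real.sq_sqrt hT.le, ← pow_mul, mul_comm d 2]
    ring
  rw [← hK]
  -- radii decreasing to `1 / 2` and levels increasing to `K`
  obtain ⟨r, hr⟩ : ∃ r : ℕ → ℝ, r = fun j => 1 / 2 + 1 / 4 * (1 / 2) ^ j := ⟨_, rfl⟩
  obtain ⟨k, hk⟩ : ∃ k : ℕ → ℝ, k = fun j => K * (1 - (1 / 2) ^ j) := ⟨_, rfl⟩
  obtain ⟨A, hA⟩ : ∃ A : ℕ → ℝ, A = fun j =>
      ∫ x in Metric.closedBall (0 : Space d) (r j), max (u x - k j) 0 ^ 2 := ⟨_, rfl⟩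
  have hp : ∀ j : ℕ, (0 : ℝ) < (1 / 2) ^ j := fun j => by positivity
  have hp1 : ∀ j : ℕ, ((1 : ℝ) / 2) ^ j ≤ 1 := fun j => pow_le_one₀ (by norm_num) (by norm_num)
  have hr1 : ∀ j, r j < 1 := fun j => by rw [hr]; linarith [hp1 j]
  have hr2 : ∀ j, 1 / 2 < r j := fun j => by rw [hr]; linarith [hp j]
  have hk0 : ∀ j, 0 ≤ k j := fun j => by
    rw [hk]
    exact mul_nonneg hK0.le (by linarith [hp1 j])
  have hkK : ∀ j, k j ≤ K := fun j => by
    rw [hk]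
    nlinarith [hp j]
  have hle : ∀ {s : ℝ}, s < 1 → volume.restrict (Metric.closedBall (0 : Space d) s) ≤
      vol (ballO d 1) := fun hs =>
    Measure.restrict_mono (Metric.closedBall_subset_ball hs) le_rfl
  have hint : ∀ {l : ℝ}, 0 ≤ l → Integrable (fun x => max (u x - l) 0 ^ 2) (vol (ballO d 1)) :=
    fun hl => (memLp_max_sub hu.1.1 hl).integrable_sq
  have hA0 : ∀ j, 0 ≤ A j := fun j => by
    rw [hA]
    exact integral_nonneg fun x => sq_nonneg _
  have hAT : A 0 ≤ T := by
    have h0 : k 0 = 0 := by simp [hk]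
    refine le_trans ?_ huT
    simp only [hA, h0, sub_zero]
    have h1 := hint le_rfl
    simp only [sub_zero] at h1
    exact integral_mono_measure (hle (hr1 0)) (Eventually.of_forall fun x => sq_nonneg _) h1
  have hrec : ∀ j, A (j + 1) ≤
      C * L * (64 * 4 ^ j) * (A j * 4 ^ (j + 1) / K ^ 2) ^ (2 / (d : ℝ)) * A j := by
    intro j
    have hrr : r j - r (j + 1) = 1 / 8 * (1 / 2) ^ j := by
      simp only [hr, pow_succ]; ring
    have hkk : k (j + 1) - k j = K * (1 / 2) ^ (j + 1) := by
      simp only [hk, pow_succ]; ring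
    have h1 := hstep a lam Lam ha u hu (r (j + 1)) (r j) (k j) (k (j + 1))
      (by linarith [hr2 (j + 1)])
      (by have : 0 < r j - r (j + 1) := by rw [hrr]; positivity
          linarith) (hr1 j) (hk0 j)
      (by have : 0 < k (j + 1) - k j := by rw [hkk]; positivity
          linarith)
    rw [← hLdef, hrr, hkk] at h1
    have e4 : ∀ n : ℕ, ((1 / 2 : ℝ) ^ n) ^ 2 = (4 ^ n)⁻¹ := fun n => by
      rw [← pow_mul, mul_comm, pow_mul, ← inv_pow]
      norm_num
    have e5 : C * L / (1 / 8 * (1 / 2) ^ j) ^ 2 = C * L * (64 * 4 ^ j) := by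
      rw [mul_pow, e4]
      field_simp
      norm_num
    have e6 : A j / (K * (1 / 2) ^ (j + 1)) ^ 2 = A j * 4 ^ (j + 1) / K ^ 2 := by
      rw [mul_pow, e4]
      field_simp
    rw [← e5, ← e6]
    simpa only [hA] using h1
  have hgeo := le_geometric_of_deGiorgi_recursion (by omega) hA0 hT hC hDL hL hθ
    (by rw [hDdef, mul_add, mul_div_cancel₀ _ hθ0.ne']; linarith) hK2 hAT hrec
  have hzero : ∫ x in Metric.closedBall (0 : Space d) (1 / 2), max (u x - K) 0 ^ 2 ≤ 0 := by
    have hlim : Tendsto (fun j : ℕ => T * θ ^ j) atTop (𝓝 0) := by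
      simpa using (tendsto_pow_atTop_nhds_zero_of_lt_one hθ0.le hθ1).const_mul T
    refine ge_of_tendsto' hlim fun j => le_trans ?_ (hgeo j)
    rw [hA]
    calc _ ≤ ∫ x in Metric.closedBall (0 : Space d) (r j), max (u x - K) 0 ^ 2 :=
          integral_mono_measure (Measure.restrict_mono
            (Metric.closedBall_subset_closedBall (hr2 j).le) le_rfl)
            (Eventually.of_forall fun x => sq_nonneg _) ((hint hK0.le).mono_measure (hle (hr1 j)))
      _ ≤ _ := by
          refine integral_mono ((hint hK0.le).mono_measure (hle (hr1 j)))
            ((hint (hk0 j)).mono_measure (hle (hr1 j))) fun x => ?_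
          exact pow_le_pow_left₀ (le_max_right _ _)
            (max_le_max_right _ (by linarith [hkK j])) 2
  have hae := (integral_eq_zero_iff_of_nonneg (fun x => sq_nonneg _)
    ((hint hK0.le).mono_measure (hle (by norm_num)))).1
    (le_antisymm hzero (integral_nonneg fun x => sq_nonneg _))
  refine ae_restrict_of_ae_restrict_of_subset Metric.ball_subset_closedBall ?_
  filter_upwards [hae] with x hx
  have h1 : max (u x - K) 0 = 0 := by simpa using hx
  linarith [le_max_left (u x - K) 0]

end DeGiorgi

theorem theorem2p1 (d : ℕ) (hd : 3 ≤ d) :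
    ∃ C : ℝ, 0 < C ∧ ∃ m : ℕ,
      ∀ (a : DeGiorgi.Space d → Matrix (Fin d) (Fin d) ℝ) (lam Lam : ℝ),
        DeGiorgi.IsElliptic (DeGiorgi.ballO d 1) a lam Lam →
      ∀ u : DeGiorgi.Space d → ℝ,
        DeGiorgi.IsWeakSubsolution (DeGiorgi.ballO d 1) a u →
        MemLp (fun x => max (u x) 0) 2 (DeGiorgi.vol (DeGiorgi.ballO d 1)) →
      ∀ᵐ x ∂(DeGiorgi.vol (DeGiorgi.ballO d (1 / 2))),
        max (u x) 0 ≤ C * (Lam / lam) ^ m *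
          (∫ y, |max (u y) 0| ^ 2 ∂(DeGiorgi.vol (DeGiorgi.ballO d 1))) ^ (1 / 2 : ℝ) := by
  obtain ⟨D, hD, hbound⟩ := DeGiorgi.exists_le_of_integral_le hd
  refine ⟨2 * D ^ d, by positivity, d, fun a lam Lam ha u hu hup => ?_⟩
  have hL : 0 ≤ Lam / lam := div_nonneg (ha.lam_pos.le.trans ha.lam_le) ha.lam_pos.le
  simp only [sq_abs]
  obtain ⟨T, hT⟩ : ∃ T, T = ∫ y, max (u y) 0 ^ 2 ∂(DeGiorgi.vol (DeGiorgi.ballO d 1)) := ⟨_, rfl⟩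
  rw [← hT, ← Real.sqrt_eq_rpow]
  have hT0 : 0 ≤ T := hT ▸ integral_nonneg fun y => sq_nonneg _
  -- for vanishing energy the level would be `0`, and the iteration needs a positive one
  rcases hT0.eq_or_lt with h0 | hpos
  · have hae := (integral_eq_zero_iff_of_nonneg (fun y => sq_nonneg _) hup.integrable_sq).1
      (hT.symm.trans h0.symm)
    refine ae_restrict_of_ae_restrict_of_subset
      (Metric.ball_subset_ball (by norm_num : (1 / 2 : ℝ) ≤ 1)) ?_
    filter_upwards [hae] with x hx
    have h1 : max (u x) 0 = 0 := by simpa using hx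
    rw [h1]
    positivity
  · filter_upwards [hbound a lam Lam ha u hu T hpos hT.symm.le] with x hx
    refine max_le (hx.trans (le_of_eq ?_)) (by positivity)
    rw [mul_pow]
    ring
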